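/- A unit gain graph $\Psi$ on a (finite, simple) graph $G$ assigns to each arc $uv$ of $G$ a gain $\psi(uv)\in\mathbb{T}=\{z\in\mathbb{C}:|z|=1\}$ with $\psi(vu)=\psi(uv)^{-1}$. Its gain matrix $A(\Psi)$ has $(u,v)$ entry $\psi(uv)$ if $u,v$ are adjacent and $0$ otherwise, and its eigenvalues are the roots of the characteristic polynomial of $A(\Psi)$. A diagonal switching replaces $A(\Psi)$ by $S^{-1}A(\Psi)S$ with $S$ a diagonal matrix with diagonal entries in $\mathbb{T}$; the converse of $\Psi$ is obtained by inverting all gains. Two gain graphs are switching isomorphic if one is obtained from the other by diagonal switching, possibly followed by taking the converse and/or relabeling the vertices. A gain graph is identified with its gain matrix. A weighing matrix of weight $k$ and order $t$ is a $t\times t$ complex matrix $W$ with entries in $\mathbb{T}\cup\{0\}$ and $WW^*=kI$. For $t\ge 3$, let $B$ be the adjacency matrix of the cycle of order $t$; the donut graph of order $2t$ is the $5$-regular graph with adjacency matrix $\begin{bmatrix} B & B+I\\ B+I & B\end{bmatrix}$. For $c\in\mathbb{T}$ let $D_8^*(c)$ be the gain graph on vertices $1,\dots,8$ whose edges and gains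 are, up to $\psi(vu)=\overline{\psi(uv)}$: $\psi(12)=\psi(23)=\psi(34)=\psi(41)=1$; $\psi(56)=\psi(67)=\psi(78)=\psi(85)=-1$; $\psi(15)=\psi(26)=\psi(37)=\psi(48)=1$; $\psi(16)=\psi(72)=\psi(38)=\psi(54)=c$; and $\psi(18)=\psi(52)=\psi(36)=\psi(74)=-c$. Theorem. Let $t\ge 3$, let $G$ be a donut graph of order $2t$, and let $\Psi$ be a unit gain graph on $G$. Then the set of distinct eigenvalues of $\Psi$ is $\{\sqrt5,-\sqrt5\}$ if and only if $\Psi$ is switching isomorphic to $$\begin{bmatrix} C+C^* & C-C^*+I\\ C^*-C+I & -C-C^*\end{bmatrix}$$ for some weighing matrix $C$ of order $t$ and weight $1$, or to $D_8^*(c)$ for some $c\in\mathbb{T}$. -/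

import Mathlib

/-- A unit gain graph on the underlying graph `G`: every arc carries a complex number of modulus
one, and the gain of the reverse arc is the inverse. -/
structure UnitGainGraph {V : Type*} (G : SimpleGraph V) where
  gain : G.Dart → Circle
  gain_symm : ∀ d : G.Dart, gain d.symm = (gain d)⁻¹

namespace UnitGainGraph

variable {V W : Type*} {G : SimpleGraph V} {H : SimpleGraph W}

open Classical in
/-- The gain matrix: the entry at `(u, v)` is the gain of the arc `uv` if `u` and `v` are adjacent,
and zero otherwise. -/
noncomputable def gainMatrix (Ψ : UnitGainGraph G) : Matrix V V ℂ :=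
  Matrix.of fun u v => if h : G.Adj u v then ((Ψ.gain ⟨(u, v), h⟩ : Circle) : ℂ) else 0

/-- The eigenvalues of a gain graph: the complex roots of the characteristic polynomial of its
gain matrix. -/
def eigenvalues [Fintype V] [DecidableEq V] (Ψ : UnitGainGraph G) : Set ℂ :=
  {z : ℂ | Ψ.gainMatrix.charpoly.IsRoot z}

/-- Diagonal switching by `S = diag (s)`; the gain matrix `A` becomes `S⁻¹ A S`. -/
noncomputable def switch (Ψ : UnitGainGraph G) (s : V → Circle) : UnitGainGraph G where
  gain d := (s d.fst)⁻¹ * Ψ.gain d * s d.snd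
  gain_symm d := by
    rw [Ψ.gain_symm]
    simp [mul_inv_rev, mul_comm, mul_left_comm]

/-- The converse: every gain is inverted. -/
noncomputable def converse (Ψ : UnitGainGraph G) : UnitGainGraph G where
  gain d := (Ψ.gain d)⁻¹
  gain_symm d := by rw [Ψ.gain_symm]

/-- Two gain graphs are isomorphic if they are equal up to a relabeling of the vertices. -/
def Isomorphic (Ψ : UnitGainGraph G) (Φ : UnitGainGraph H) : Prop :=
  ∃ e : V ≃ W, ∀ u v : V, Φ.gainMatrix (e u) (e v) = Ψ.gainMatrix u v

/-- Switching isomorphism: a diagonal switching, possibly followed by taking the converse,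
followed by a relabeling of the vertices. (A sequence of diagonal switchings is a single one.) -/
def SwitchingIsomorphic (Ψ : UnitGainGraph G) (Φ : UnitGainGraph H) : Prop :=
  ∃ s : V → Circle, (Ψ.switch s).Isomorphic Φ ∨ (Ψ.switch s).converse.Isomorphic Φ

/-- `Ψ` is switching isomorphic to a gain graph whose gain matrix is `M`. -/
def SwitchingIsomorphicToMatrix (Ψ : UnitGainGraph G) (M : Matrix W W ℂ) : Prop :=
  ∃ (K : SimpleGraph W) (Φ : UnitGainGraph K), Φ.gainMatrix = M ∧ Ψ.SwitchingIsomorphic Φ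

/-- The switched gain matrix is `S⁻¹ A S`. -/
theorem gainMatrix_switch [Fintype V] [DecidableEq V] (Ψ : UnitGainGraph G) (s : V → Circle) :
    (Ψ.switch s).gainMatrix =
      (Matrix.diagonal fun v => (s v : ℂ))⁻¹ * Ψ.gainMatrix *
        Matrix.diagonal fun v => (s v : ℂ) := by
  have h : (Matrix.diagonal fun v => (s v : ℂ))⁻¹ = Matrix.diagonal fun v => (s v : ℂ)⁻¹ := by
    apply Matrix.inv_eq_right_inv
    rw [Matrix.diagonal_mul_diagonal, ← Matrix.diagonal_one]
    congr 1
    funext v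
    exact mul_inv_cancel₀ (Circle.coe_ne_zero (s v))
  rw [h]
  ext u v
  rw [Matrix.mul_diagonal, Matrix.diagonal_mul]
  by_cases huv : G.Adj u v <;> simp [gainMatrix, switch, huv]

end UnitGainGraph

/-- The donut graph of order `2t`: two copies of the cycle of order `t`, where vertices of
different copies are adjacent if their positions on the cycle are equal or adjacent. -/
def donutGraph (t : ℕ) : SimpleGraph (Fin t ⊕ Fin t) where
  Adj
    | .inl i, .inl j => (SimpleGraph.cycleGraph t).Adj i j
    | .inl i, .inr j => (SimpleGraph.cycleGraph t).Adj i j ∨ i = j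
    | .inr i, .inl j => (SimpleGraph.cycleGraph t).Adj i j ∨ i = j
    | .inr i, .inr j => (SimpleGraph.cycleGraph t).Adj i j
  symm := ⟨by
    rintro (i | i) (j | j) h
    · exact h.symm
    · exact h.imp SimpleGraph.Adj.symm Eq.symm
    · exact h.imp SimpleGraph.Adj.symm Eq.symm
    · exact h.symm⟩
  loopless := ⟨by rintro (i | i) h <;> exact SimpleGraph.irrefl _ h⟩

open Classical in
/-- With `B` the adjacency matrix of the cycle, the adjacency matrix of the donut graph is
`[[B, B + I], [B + I, B]]`. -/
theorem adjMatrix_donutGraph (t : ℕ) :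
    (donutGraph t).adjMatrix ℂ =
      Matrix.fromBlocks ((SimpleGraph.cycleGraph t).adjMatrix ℂ)
        ((SimpleGraph.cycleGraph t).adjMatrix ℂ + 1)
        ((SimpleGraph.cycleGraph t).adjMatrix ℂ + 1)
        ((SimpleGraph.cycleGraph t).adjMatrix ℂ) := by
  ext (i | i) (j | j) <;> rw [SimpleGraph.adjMatrix_apply] <;> by_cases hij : i = j <;>
    simp [donutGraph, hij] <;> congr

/-- A (complex unit) weighing matrix of weight `k`: every nonzero entry has modulus one, and
`W W* = k I`. -/
def IsWeighingMatrix {t : ℕ} (W : Matrix (Fin t) (Fin t) ℂ) (k : ℕ) : Prop :=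
  (∀ i j, W i j = 0 ∨ ‖W i j‖ = 1) ∧ W * W.conjTranspose = (k : ℂ) • (1 : Matrix _ _ ℂ)

/-- The matrix `[[C + C*, C - C* + I], [C* - C + I, -C - C*]]`. -/
noncomputable def donutMatrix {t : ℕ} (C : Matrix (Fin t) (Fin t) ℂ) :
    Matrix (Fin t ⊕ Fin t) (Fin t ⊕ Fin t) ℂ :=
  Matrix.fromBlocks (C + C.conjTranspose) (C - C.conjTranspose + 1)
    (C.conjTranspose - C + 1) (-C - C.conjTranspose)

/-- The gain matrix of the exceptional order-8 gain graph with parameter `c`. The vertices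
`0, 1, 2, 3` form the inner and `4, 5, 6, 7` the outer 4-cycle; `c'` is the conjugate of `c`. -/
noncomputable def dStarEight (c : Circle) : Matrix (Fin 8) (Fin 8) ℂ :=
  let c' : ℂ := (starRingEnd ℂ) (c : ℂ)
  !![ 0,   1,   0,   1,   1,   c,   0,  -c;
      1,   0,   1,   0,  -c',  1,   c',  0;
      0,   1,   0,   1,   0,  -c,   1,   c;
      1,   0,   1,   0,   c',  0,  -c',  1;
      1,  -c,   0,   c,   0,  -1,   0,  -1;
      c',  1,  -c',  0,  -1,   0,  -1,   0;
      0,   c,   1,  -c,   0,  -1,   0,  -1;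
     -c',  0,   c',  1,  -1,   0,  -1,   0]

/-! A gain matrix is Hermitian with zero trace. Its distinct eigenvalues are therefore `±√5` exactly
when its square is `5 I`: diagonalisability gives one direction, and the vanishing trace makes both
signs occur (`UnitGainGraph.eigenvalues_eq_iff`). Switching, relabeling and converse all preserve
this equation, and both families satisfy it by direct computation. The content is the classification
of the gain matrices with `A * A = 5 I`.

Think of the vertices as columns `{inl i, inr i}` arranged in a cycle, and switch so that the edge
inside each column has gain 1. For `t ≥ 4` the equations between neighbouring columns force the
block from column `i` to column `i + 1` to be `[[a, b], [-b, -a]]`.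

For `t ≥ 5`, columns at distance two are linked through only one intermediate column. This yields `b
= ε a` with one sign `ε = ±1` around the whole cycle, hence a donut matrix
(`exists_eq_donutMatrix_of_two_le`).

For `t = 4`, opposite columns are linked through two intermediate columns, and the ratios `z = b /
a` need only share a real part. A real ratio gives a donut matrix; otherwise, swapping the two
vertices of some columns makes the ratios alternate `w, conj w, w, conj w`, which gives `dStarEight`
(`exists_switchEquivalent_of_four`).

For `t = 3` the graph is complete and `A` is a Hermitian complex conference matrix of order 6. With
its first row normalized, each other row has four unit entries summing to zero, hence two opposite
pairs (`opposite_pairs_of_sum_eq_zero`). A case analysis on these pairs finds a row of shape `x, x,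
-x, -x`, which forces `x = ±1` and a donut matrix (`isDonutEquivalent_of_row_eq`). -/

open ComplexConjugate

/-! ### Switching equivalence of matrices, without the converse -/

/-- `M` arises from `A` by a diagonal switching with unit complex numbers and a relabeling. -/
def SwitchEquivalent {V W : Type*} (A : Matrix V V ℂ) (M : Matrix W W ℂ) : Prop :=
  ∃ (s : V → ℂ) (e : V ≃ W), (∀ v, ‖s v‖ = 1) ∧
    ∀ u v, M (e u) (e v) = conj (s u) * A u v * s v

theorem conj_mul_self_of_norm_one {z : ℂ} (h : ‖z‖ = 1) : conj z * z = 1 := by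
  rw [Complex.conj_mul', h]; simp

theorem mul_conj_self_of_norm_one {z : ℂ} (h : ‖z‖ = 1) : z * conj z = 1 := by
  rw [Complex.mul_conj', h]; simp

namespace SwitchEquivalent

variable {U V W : Type*} {A : Matrix U U ℂ} {B : Matrix V V ℂ} {M : Matrix W W ℂ}

theorem trans (h : SwitchEquivalent A B) (k : SwitchEquivalent B M) : SwitchEquivalent A M := by
  obtain ⟨s, e, hs, h⟩ := h
  obtain ⟨r, f, hr, k⟩ := k
  refine ⟨fun v => s v * r (e v), e.trans f, fun v => by simp [hs, hr], fun u v => ?_⟩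
  simp only [Equiv.trans_apply, k, h, map_mul]
  ring

theorem of_submatrix (A : Matrix U U ℂ) (e : V ≃ U) : SwitchEquivalent A (A.submatrix e e) :=
  ⟨fun _ => 1, e.symm, fun _ => by simp, fun u v => by simp⟩

theorem of_switch (A : Matrix U U ℂ) (s : U → ℂ) (hs : ∀ u, ‖s u‖ = 1) :
    SwitchEquivalent A (Matrix.of fun u v => conj (s u) * A u v * s v) :=
  ⟨s, Equiv.refl _, hs, fun u v => by simp⟩

/-- Switching and relabeling amount to a unitary similarity, under which a scalar matrix is
invariant. -/
theorem mul_self [Fintype U] [Fintype V] [DecidableEq U] [DecidableEq V]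
    (h : SwitchEquivalent A B) {k : ℂ} (hB : B * B = k • (1 : Matrix V V ℂ)) :
    A * A = k • (1 : Matrix U U ℂ) := by
  obtain ⟨s, e, hs, h⟩ := h
  have hA : ∀ u v, A u v = s u * B (e u) (e v) * conj (s v) := by
    intro u v
    rw [h]
    linear_combination (-A u v * (s v * conj (s v))) * mul_conj_self_of_norm_one (hs u) -
      A u v * mul_conj_self_of_norm_one (hs v)
  ext u v
  have hB' := congrFun (congrFun hB (e u)) (e v)
  rw [Matrix.mul_apply, ← e.sum_comp] at hB'
  rw [Matrix.mul_apply]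
  have : ∀ w, A u w * A w v = s u * (B (e u) (e w) * B (e w) (e v)) * conj (s v) := by
    intro w
    rw [hA u w, hA w v]
    linear_combination (s u * B (e u) (e w) * B (e w) (e v) * conj (s v)) *
      conj_mul_self_of_norm_one (hs w)
  simp only [this, ← Finset.sum_mul, ← Finset.mul_sum, hB', Matrix.smul_apply, Matrix.one_apply,
    e.apply_eq_iff_eq]
  split_ifs with huv
  · subst huv
    simp only [smul_eq_mul]
    linear_combination k * mul_conj_self_of_norm_one (hs u)
  · simp

end SwitchEquivalent

/-! ### Gain matrices and their switching isomorphisms -/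

namespace UnitGainGraph

variable {V W : Type*} {G : SimpleGraph V}

theorem gainMatrix_of_adj (Ψ : UnitGainGraph G) {u v : V} (h : G.Adj u v) :
    Ψ.gainMatrix u v = Ψ.gain ⟨(u, v), h⟩ := by
  simp [gainMatrix, h]

theorem gainMatrix_of_not_adj (Ψ : UnitGainGraph G) {u v : V} (h : ¬ G.Adj u v) :
    Ψ.gainMatrix u v = 0 := by
  simp [gainMatrix, h]

theorem norm_gainMatrix (Ψ : UnitGainGraph G) {u v : V} (h : G.Adj u v) :
    ‖Ψ.gainMatrix u v‖ = 1 := by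
  rw [gainMatrix_of_adj _ h, Circle.norm_coe]

theorem conj_gainMatrix (Ψ : UnitGainGraph G) (u v : V) :
    conj (Ψ.gainMatrix u v) = Ψ.gainMatrix v u := by
  by_cases h : G.Adj u v
  · rw [Ψ.gainMatrix_of_adj h, Ψ.gainMatrix_of_adj h.symm]
    have := Ψ.gain_symm ⟨(u, v), h⟩
    simp only [SimpleGraph.Dart.symm, Prod.swap] at this
    rw [this, Circle.coe_inv_eq_conj]
  · rw [Ψ.gainMatrix_of_not_adj h, Ψ.gainMatrix_of_not_adj fun k => h k.symm, map_zero]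

theorem isHermitian_gainMatrix (Ψ : UnitGainGraph G) : Ψ.gainMatrix.IsHermitian := by
  ext u v
  exact Ψ.conj_gainMatrix v u

theorem switch_gainMatrix_apply (Ψ : UnitGainGraph G) (s : V → Circle) (u v : V) :
    (Ψ.switch s).gainMatrix u v = conj (s u : ℂ) * Ψ.gainMatrix u v * s v := by
  by_cases h : G.Adj u v
  · rw [gainMatrix_of_adj _ h, gainMatrix_of_adj _ h]
    simp [switch, ← Circle.coe_inv_eq_conj]
  · simp [gainMatrix_of_not_adj _ h]

theorem converse_gainMatrix_apply (Ψ : UnitGainGraph G) (u v : V) :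
    Ψ.converse.gainMatrix u v = conj (Ψ.gainMatrix u v) := by
  by_cases h : G.Adj u v
  · rw [gainMatrix_of_adj _ h, gainMatrix_of_adj _ h]
    simp [converse, ← Circle.coe_inv_eq_conj]
  · simp [gainMatrix_of_not_adj _ h]

/-- Relabeling the vertices of a gain graph. -/
def relabel (Ψ : UnitGainGraph G) (e : V ≃ W) : UnitGainGraph (G.comap e.symm) where
  gain d := Ψ.gain ⟨(e.symm d.fst, e.symm d.snd), d.adj⟩
  gain_symm d := Ψ.gain_symm ⟨(e.symm d.fst, e.symm d.snd), d.adj⟩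

theorem relabel_gainMatrix_apply (Ψ : UnitGainGraph G) (e : V ≃ W) (u v : W) :
    (Ψ.relabel e).gainMatrix u v = Ψ.gainMatrix (e.symm u) (e.symm v) := by
  by_cases h : G.Adj (e.symm u) (e.symm v)
  · rw [gainMatrix_of_adj _ h, gainMatrix_of_adj _ (show (G.comap e.symm).Adj u v from h)]
    rfl
  · rw [gainMatrix_of_not_adj _ h,
      gainMatrix_of_not_adj _ (show ¬ (G.comap e.symm).Adj u v from h)]

theorem switchingIsomorphicToMatrix_of_switchEquivalent (Ψ : UnitGainGraph G) {M : Matrix W W ℂ}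
    (h : SwitchEquivalent Ψ.gainMatrix M) : Ψ.SwitchingIsomorphicToMatrix M := by
  obtain ⟨s, e, hs, h⟩ := h
  have hc : ∀ v, ∃ c : Circle, (c : ℂ) = s v := fun v =>
    ⟨⟨s v, mem_sphere_zero_iff_norm.2 (hs v)⟩, rfl⟩
  choose c hc using hc
  refine ⟨_, (Ψ.switch c).relabel e, ?_, c, Or.inl ⟨e, fun u v => ?_⟩⟩
  · ext u v
    have := h (e.symm u) (e.symm v)
    rw [relabel_gainMatrix_apply, switch_gainMatrix_apply, hc, hc, ← this]
    simp
  · simp [relabel_gainMatrix_apply]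

/-- The converse conjugates every entry. Since `k` is real, the equation for the square survives
this. -/
theorem mul_self_of_switchingIsomorphicToMatrix [Fintype V] [DecidableEq V] [Fintype W]
    [DecidableEq W] (Ψ : UnitGainGraph G) {M : Matrix W W ℂ}
    (h : Ψ.SwitchingIsomorphicToMatrix M) {k : ℝ} (hM : M * M = (k : ℂ) • (1 : Matrix W W ℂ)) :
    Ψ.gainMatrix * Ψ.gainMatrix = (k : ℂ) • (1 : Matrix V V ℂ) := by
  obtain ⟨K, Φ, rfl, s, ⟨e, h⟩ | ⟨e, h⟩⟩ := h
  · refine SwitchEquivalent.mul_self (B := Φ.gainMatrix)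
      ⟨fun v => s v, e, fun v => Circle.norm_coe _, ?_⟩ hM
    intro u v
    rw [h, switch_gainMatrix_apply]
  · refine SwitchEquivalent.mul_self (B := Φ.gainMatrix.map conj)
      ⟨fun v => s v, e, fun v => Circle.norm_coe _, ?_⟩ ?_
    · intro u v
      rw [Matrix.map_apply, h, converse_gainMatrix_apply, switch_gainMatrix_apply]
      simp
    · rw [← Matrix.map_mul, hM]
      ext i j
      by_cases hij : i = j <;> simp [hij]

theorem trace_gainMatrix [Fintype V] (Ψ : UnitGainGraph G) : Ψ.gainMatrix.trace = 0 := by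
  refine Finset.sum_eq_zero fun v _ => ?_
  exact Ψ.gainMatrix_of_not_adj (G.loopless.irrefl v)

end UnitGainGraph

/-! ### Two-eigenvalue spectra as a quadratic matrix equation -/

/-- Since `(r - A) (r + A) = 0`, invertibility of `r - A` would give `A = -r`, whose trace is
nonzero. -/
theorem Matrix.isRoot_charpoly_of_mul_self {V : Type*} [Fintype V] [DecidableEq V] [Nonempty V]
    {A : Matrix V V ℂ} {r : ℂ} (hr : r ≠ 0) (hA : A * A = (r ^ 2) • (1 : Matrix V V ℂ))
    (htr : A.trace = 0) : A.charpoly.IsRoot r := by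
  rw [Polynomial.IsRoot, Matrix.eval_charpoly]
  by_contra h
  have hu : IsUnit (Matrix.scalar V r - A) :=
    (Matrix.isUnit_iff_isUnit_det _).2 (isUnit_iff_ne_zero.2 h)
  have hmul : (Matrix.scalar V r - A) * (Matrix.scalar V r + A) = 0 := by
    have hc : Matrix.scalar V r = r • (1 : Matrix V V ℂ) := by
      ext i j; simp [Matrix.one_apply, Matrix.diagonal_apply]
    rw [hc, sub_mul, mul_add, mul_add, hA]
    simp [smul_smul, sq, add_comm]
  have h0 : Matrix.scalar V r + A = 0 := (hu.mul_right_eq_zero).1 hmul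
  have := congrArg Matrix.trace h0
  rw [Matrix.trace_add, htr] at this
  simp [Matrix.trace, hr] at this

theorem Matrix.IsHermitian.mul_self_of_roots_charpoly {V : Type*} [Fintype V] [DecidableEq V]
    {A : Matrix V V ℂ} (hA : A.IsHermitian) {k : ℂ} (h : ∀ z, A.charpoly.IsRoot z → z ^ 2 = k) :
    A * A = k • (1 : Matrix V V ℂ) := by
  have hd : Matrix.diagonal (RCLike.ofReal ∘ hA.eigenvalues : V → ℂ) *
      Matrix.diagonal (RCLike.ofReal ∘ hA.eigenvalues) = k • (1 : Matrix V V ℂ) := by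
    rw [Matrix.diagonal_mul_diagonal, ← Matrix.diagonal_one, ← Matrix.diagonal_smul]
    congr 1
    ext i
    have hi : A.charpoly.IsRoot ((hA.eigenvalues i : ℝ) : ℂ) := by
      rw [hA.charpoly_eq, Polynomial.IsRoot, Polynomial.eval_prod]
      exact Finset.prod_eq_zero (Finset.mem_univ i) (by simp)
    have := h _ hi
    simpa [sq] using this
  rw [hA.spectral_theorem, ← map_mul, hd, map_smul, map_one]

theorem UnitGainGraph.eigenvalues_eq_iff {V : Type*} [Fintype V] [DecidableEq V] [Nonempty V]
    {G : SimpleGraph V} (Ψ : UnitGainGraph G) {k : ℝ} (hk : 0 < k) :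
    Ψ.eigenvalues = {((√k : ℝ) : ℂ), -((√k : ℝ) : ℂ)} ↔
      Ψ.gainMatrix * Ψ.gainMatrix = (k : ℂ) • (1 : Matrix V V ℂ) := by
  have hs : ((√k : ℝ) : ℂ) ^ 2 = k := by
    rw [← Complex.ofReal_pow, Real.sq_sqrt hk.le]
  have hs0 : ((√k : ℝ) : ℂ) ≠ 0 := by
    rw [Complex.ofReal_ne_zero]
    exact (Real.sqrt_pos.2 hk).ne'
  constructor
  · intro h
    refine Ψ.isHermitian_gainMatrix.mul_self_of_roots_charpoly fun z hz => ?_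
    have : z ∈ Ψ.eigenvalues := hz
    rw [h] at this
    rcases this with rfl | hz
    · exact hs
    · rw [Set.mem_singleton_iff.1 hz, neg_sq, hs]
  · intro h
    ext z
    constructor
    · intro hz
      have hz : (Ψ.gainMatrix.charpoly).IsRoot z := hz
      rw [Polynomial.IsRoot, Matrix.eval_charpoly, ← Matrix.exists_mulVec_eq_zero_iff] at hz
      obtain ⟨v, hv, hz⟩ := hz
      have h1 : Ψ.gainMatrix.mulVec v = z • v := by
        rw [Matrix.sub_mulVec, sub_eq_zero] at hz
        rw [← hz]
        ext i
        simp [Matrix.mulVec_diagonal]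
      have h2 : (k : ℂ) • v = z ^ 2 • v := by
        rw [sq, mul_smul, ← h1, ← Matrix.mulVec_smul, ← h1, Matrix.mulVec_mulVec, h,
          Matrix.smul_mulVec, Matrix.one_mulVec]
      have h3 : (k : ℂ) = z ^ 2 := smul_left_injective _ hv h2
      have h4 : (z - ((√k : ℝ) : ℂ)) * (z + ((√k : ℝ) : ℂ)) = 0 := by
        linear_combination -h3 - hs
      rcases mul_eq_zero.1 h4 with h4 | h4
      · exact Or.inl (sub_eq_zero.1 h4)
      · exact Or.inr (eq_neg_of_add_eq_zero_left h4)
    · rintro (rfl | hz)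
      · exact Matrix.isRoot_charpoly_of_mul_self hs0 (by rw [h, hs]) Ψ.trace_gainMatrix
      · rw [Set.mem_singleton_iff.1 hz]
        exact Matrix.isRoot_charpoly_of_mul_self (neg_ne_zero.2 hs0) (by rw [h, neg_sq, hs])
          Ψ.trace_gainMatrix

/-! ### Both families have square `5 I` -/

theorem IsWeighingMatrix.conjTranspose_mul_self {t : ℕ} {C : Matrix (Fin t) (Fin t) ℂ}
    (hC : IsWeighingMatrix C 1) : C.conjTranspose * C = 1 := by
  have := hC.2
  rw [Nat.cast_one, one_smul] at this
  exact mul_eq_one_comm.1 this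

theorem IsWeighingMatrix.conjTranspose {t : ℕ} {C : Matrix (Fin t) (Fin t) ℂ}
    (hC : IsWeighingMatrix C 1) : IsWeighingMatrix C.conjTranspose 1 := by
  refine ⟨fun i j => ?_, ?_⟩
  · simpa using hC.1 j i
  · simpa using hC.conjTranspose_mul_self

/-- With `S = C + C*` and `D = C - C*`, the upper diagonal block is `S² + (1 + D)(1 - D) = 1 + 2(CC*
+ C*C) = 5`. The off-diagonal blocks are commutators of `S` and `D` up to sign, which vanish because
`C` is normal. -/
theorem donutMatrix_mul_self {t : ℕ} {C : Matrix (Fin t) (Fin t) ℂ} (hC : IsWeighingMatrix C 1) :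
    donutMatrix C * donutMatrix C = (5 : ℂ) • (1 : Matrix _ _ ℂ) := by
  have h1 : C * C.conjTranspose = 1 := by simpa using hC.2
  have h2 := hC.conjTranspose_mul_self
  rw [donutMatrix, Matrix.fromBlocks_multiply, ← Matrix.fromBlocks_one, Matrix.fromBlocks_smul]
  have h5 : (5 : ℂ) • (1 : Matrix (Fin t) (Fin t) ℂ) = 1 + 1 + 1 + 1 + 1 := by
    ext i j
    simp only [Matrix.smul_apply, Matrix.add_apply, smul_eq_mul]
    ring
  rw [h5]
  congr 1 <;> noncomm_ring <;> simp only [h1, h2] <;> module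

theorem dStarEight_mul_self (c : Circle) :
    dStarEight c * dStarEight c = (5 : ℂ) • (1 : Matrix _ _ ℂ) := by
  have h : (c : ℂ) * conj (c : ℂ) = 1 := mul_conj_self_of_norm_one (Circle.norm_coe c)
  ext i j
  rw [Matrix.mul_apply, Fin.sum_univ_eight]
  fin_cases i <;> fin_cases j <;> simp [dStarEight, h, mul_comm (conj (c : ℂ))] <;> norm_num

/-! ### Cyclic positions and adjacency of columns -/

namespace Fin

variable {n : ℕ}

theorem one_add_one_ne_zero' : (1 : Fin (n + 3)) + 1 ≠ 0 := by
  simp [Fin.ext_iff, Fin.val_add, Nat.mod_eq_of_lt]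

theorem add_one_ne_self (i : Fin (n + 3)) : i + 1 ≠ i := by
  simp

theorem add_one_add_one_ne_self (i : Fin (n + 3)) : i + 1 + 1 ≠ i := by
  rw [add_assoc]
  simpa using one_add_one_ne_zero'

theorem add_one_add_one_add_one_ne_self (hn : 1 ≤ n) (i : Fin (n + 3)) : i + 1 + 1 + 1 ≠ i := by
  rw [add_assoc, add_assoc, Ne, add_eq_left, Fin.ext_iff]
  simp only [Fin.val_add, Fin.val_one', Fin.val_zero]
  rw [Nat.mod_eq_of_lt (by omega : 1 < n + 3), Nat.mod_eq_of_lt (by omega : 1 + 1 < n + 3),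
    Nat.mod_eq_of_lt (by omega : _ < n + 3)]
  omega

theorem add_four_ones_ne_self (hn : 2 ≤ n) (i : Fin (n + 3)) : i + 1 + 1 + 1 + 1 ≠ i := by
  rw [add_assoc, add_assoc, add_assoc, Ne, add_eq_left, Fin.ext_iff]
  simp only [Fin.val_add, Fin.val_one', Fin.val_zero]
  rw [Nat.mod_eq_of_lt (by omega : 1 < n + 3), Nat.mod_eq_of_lt (by omega : 1 + 1 < n + 3),
    Nat.mod_eq_of_lt (by omega : 1 + (1 + 1) < n + 3), Nat.mod_eq_of_lt (by omega : _ < n + 3)]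
  omega

theorem forall_of_add_one {P : Fin (n + 3) → Prop} (h0 : P 0) (h : ∀ i, P i → P (i + 1)) :
    ∀ i, P i := by
  intro i
  induction i using Fin.induction with
  | zero => exact h0
  | succ i ih => simpa using h _ ih

theorem sum_eq_three {f : Fin (n + 3) → ℂ} (i : Fin (n + 3))
    (hf : ∀ k, k ≠ i → k ≠ i + 1 → i ≠ k + 1 → f k = 0) :
    ∑ k, f k = f i + f (i + 1) + f (i - 1) := by
  have h1 : i - 1 ≠ i := by simp
  have h2 : i + 1 ≠ i - 1 := fun h => add_one_add_one_ne_self (i - 1) (by simp [h])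
  rw [← Finset.sum_subset (Finset.subset_univ {i, i + 1, i - 1})]
  · rw [Finset.sum_insert, Finset.sum_insert, Finset.sum_singleton, add_assoc]
    · simpa using h2
    · simp only [Finset.mem_insert, Finset.mem_singleton, not_or]
      exact ⟨(add_one_ne_self i).symm, h1.symm⟩
  · intro k _ hk
    simp only [Finset.mem_insert, Finset.mem_singleton, not_or] at hk
    exact hf k hk.1 hk.2.1 fun h => hk.2.2 (by simp [h])

end Fin

section donutGraphAdj

variable {n : ℕ} {i j : Fin (n + 3)}

theorem cycleGraph_adj_iff :
    (SimpleGraph.cycleGraph (n + 3)).Adj i j ↔ j = i + 1 ∨ i = j + 1 := by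
  rw [SimpleGraph.cycleGraph_adj, or_comm, sub_eq_iff_eq_add', sub_eq_iff_eq_add']

theorem donutGraph_adj_inl_inl : (donutGraph (n + 3)).Adj (.inl i) (.inl j) ↔
    j = i + 1 ∨ i = j + 1 := cycleGraph_adj_iff

theorem donutGraph_adj_inr_inr : (donutGraph (n + 3)).Adj (.inr i) (.inr j) ↔
    j = i + 1 ∨ i = j + 1 := cycleGraph_adj_iff

theorem donutGraph_adj_inl_inr : (donutGraph (n + 3)).Adj (.inl i) (.inr j) ↔
    (j = i + 1 ∨ i = j + 1) ∨ i = j := or_congr cycleGraph_adj_iff Iff.rfl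

theorem donutGraph_adj_inr_inl : (donutGraph (n + 3)).Adj (.inr i) (.inl j) ↔
    (j = i + 1 ∨ i = j + 1) ∨ i = j := or_congr cycleGraph_adj_iff Iff.rfl

end donutGraphAdj

/-! ### Local equations between columns, and the case `t ≥ 5` -/

/-- A gain matrix on the donut graph whose square is `5 I`. -/
structure IsDonutGainMatrix {n : ℕ}
    (A : Matrix (Fin (n + 3) ⊕ Fin (n + 3)) (Fin (n + 3) ⊕ Fin (n + 3)) ℂ) : Prop where
  conj_apply : ∀ u v, conj (A u v) = A v u
  norm_apply : ∀ u v, (donutGraph (n + 3)).Adj u v → ‖A u v‖ = 1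
  apply_eq_zero : ∀ u v, ¬ (donutGraph (n + 3)).Adj u v → A u v = 0
  mul_self : A * A = (5 : ℂ) • (1 : Matrix _ _ ℂ)

/-- A gain matrix on the donut graph with square `5 I` and gain `1` on each edge between the two
vertices at the same position of the cycle. -/
structure IsNormalizedDonut {n : ℕ}
    (A : Matrix (Fin (n + 3) ⊕ Fin (n + 3)) (Fin (n + 3) ⊕ Fin (n + 3)) ℂ) : Prop
    extends IsDonutGainMatrix A where
  inl_inr_self : ∀ i, A (.inl i) (.inr i) = 1

namespace IsDonutGainMatrix

open Sum

variable {n : ℕ} {A : Matrix (Fin (n + 3) ⊕ Fin (n + 3)) (Fin (n + 3) ⊕ Fin (n + 3)) ℂ}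

theorem inl_inl_self (hA : IsDonutGainMatrix A) (i) : A (inl i) (inl i) = 0 :=
  hA.apply_eq_zero _ _ (SimpleGraph.irrefl _)

theorem inr_inr_self (hA : IsDonutGainMatrix A) (i) : A (inr i) (inr i) = 0 :=
  hA.apply_eq_zero _ _ (SimpleGraph.irrefl _)

theorem apply_eq_zero_of_ne (hA : IsDonutGainMatrix A) {i j : Fin (n + 3)} (h1 : i ≠ j)
    (h2 : j ≠ i + 1) (h3 : i ≠ j + 1) : A (inl i) (inl j) = 0 ∧ A (inl i) (inr j) = 0 ∧
      A (inr i) (inl j) = 0 ∧ A (inr i) (inr j) = 0 := by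
  refine ⟨hA.apply_eq_zero _ _ ?_, hA.apply_eq_zero _ _ ?_, hA.apply_eq_zero _ _ ?_,
    hA.apply_eq_zero _ _ ?_⟩
  · simp [donutGraph_adj_inl_inl, h2, h3]
  · simp [donutGraph_adj_inl_inr, h1, h2, h3]
  · simp [donutGraph_adj_inr_inl, h1, h2, h3]
  · simp [donutGraph_adj_inr_inr, h2, h3]

theorem norm_inl_inr_self (hA : IsDonutGainMatrix A) (i) : ‖A (inl i) (inr i)‖ = 1 :=
  hA.norm_apply _ _ (by simp [donutGraph_adj_inl_inr])

theorem norm_inl_inl (hA : IsDonutGainMatrix A) (i) : ‖A (inl i) (inl (i + 1))‖ = 1 :=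
  hA.norm_apply _ _ (by simp [donutGraph_adj_inl_inl])

theorem norm_inl_inr (hA : IsDonutGainMatrix A) (i) : ‖A (inl i) (inr (i + 1))‖ = 1 :=
  hA.norm_apply _ _ (by simp [donutGraph_adj_inl_inr])

/-- The row of `inl i` in `A * A`, with the sum cut down to the columns `i`, `i + 1` and `i - 1`. -/
theorem sum_inl (hA : IsDonutGainMatrix A) (i : Fin (n + 3)) (v : Fin (n + 3) ⊕ Fin (n + 3)) :
    (A (inl i) (inr i) * A (inr i) v) +
      (A (inl i) (inl (i + 1)) * A (inl (i + 1)) v + A (inl i) (inr (i + 1)) * A (inr (i + 1)) v) +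
      (A (inl i) (inl (i - 1)) * A (inl (i - 1)) v + A (inl i) (inr (i - 1)) * A (inr (i - 1)) v) =
      5 * (1 : Matrix (Fin (n + 3) ⊕ Fin (n + 3)) (Fin (n + 3) ⊕ Fin (n + 3)) ℂ) (inl i) v := by
  have h := congrFun (congrFun hA.mul_self (inl i)) v
  rw [Matrix.mul_apply, Fintype.sum_sum_type, ← Finset.sum_add_distrib, Fin.sum_eq_three i,
    hA.inl_inl_self, zero_mul, zero_add, Matrix.smul_apply, smul_eq_mul] at h
  · exact h
  · intro k h1 h2 h3
    obtain ⟨e1, e2, -, -⟩ := hA.apply_eq_zero_of_ne h1.symm h2 h3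
    rw [e1, e2, zero_mul, zero_mul, zero_add]


theorem switch (hA : IsDonutGainMatrix A) {s : Fin (n + 3) ⊕ Fin (n + 3) → ℂ}
    (hs : ∀ u, ‖s u‖ = 1) :
    IsDonutGainMatrix (Matrix.of fun u v => conj (s u) * A u v * s v) := by
  refine ⟨fun u v => ?_, fun u v h => ?_, fun u v h => ?_, ?_⟩
  · simp only [Matrix.of_apply, map_mul, Complex.conj_conj, hA.conj_apply]
    ring
  · simp [hA.norm_apply u v h, hs]
  · simp [hA.apply_eq_zero u v h]
  · refine SwitchEquivalent.mul_self ⟨fun u => conj (s u), Equiv.refl _, by simpa using hs,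
      fun u v => ?_⟩ hA.mul_self
    simp only [Equiv.refl_apply, Matrix.of_apply, Complex.conj_conj]
    linear_combination (-A u v * (s v * conj (s v))) * mul_conj_self_of_norm_one (hs u) -
      A u v * mul_conj_self_of_norm_one (hs v)

theorem exists_normalized (hA : IsDonutGainMatrix A) :
    ∃ B : Matrix (Fin (n + 3) ⊕ Fin (n + 3)) (Fin (n + 3) ⊕ Fin (n + 3)) ℂ,
      SwitchEquivalent A B ∧ IsNormalizedDonut B := by
  let s : Fin (n + 3) ⊕ Fin (n + 3) → ℂ := Sum.elim 1 fun i => conj (A (inl i) (inr i))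
  have hs : ∀ u, ‖s u‖ = 1 := by
    rintro (i | i)
    · simp [s]
    · simp [s, hA.norm_inl_inr_self]
  refine ⟨_, SwitchEquivalent.of_switch A s hs, hA.switch hs, fun i => ?_⟩
  simp [s, mul_conj_self_of_norm_one (hA.norm_inl_inr_self i)]

end IsDonutGainMatrix

namespace IsNormalizedDonut

open Sum

variable {n : ℕ} {A : Matrix (Fin (n + 3) ⊕ Fin (n + 3)) (Fin (n + 3) ⊕ Fin (n + 3)) ℂ}

theorem inr_inl_self (hA : IsNormalizedDonut A) (i) : A (inr i) (inl i) = 1 := by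
  rw [← hA.conj_apply, hA.inl_inr_self, map_one]

/-- For `t ≥ 4` the columns `i - 1` and `i + 1` are neither equal nor adjacent, so the only walks of
length two from `inl i` to `inl (i + 1)` pass through `inr i` and `inr (i + 1)`. -/
theorem inr_inl (hA : IsNormalizedDonut A) (hn : 1 ≤ n) (i) :
    A (inr i) (inl (i + 1)) = -A (inl i) (inr (i + 1)) := by
  have h := hA.sum_inl i (inl (i + 1))
  obtain ⟨e1, -, e2, -⟩ := hA.apply_eq_zero_of_ne (i := i - 1) (j := i + 1)
    (fun h => Fin.add_one_add_one_ne_self (i - 1) (by simp [← h]))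
    (by simp)
    (fun h => Fin.add_one_add_one_add_one_ne_self hn (i - 1) (by simp [← h]))
  rw [hA.inl_inr_self, hA.inl_inl_self, hA.inr_inl_self, e1, e2,
    Matrix.one_apply_ne (by simp)] at h
  linear_combination h

theorem inr_inr (hA : IsNormalizedDonut A) (hn : 1 ≤ n) (i) :
    A (inr i) (inr (i + 1)) = -A (inl i) (inl (i + 1)) := by
  have h := hA.sum_inl i (inr (i + 1))
  obtain ⟨-, e1, -, e2⟩ := hA.apply_eq_zero_of_ne (i := i - 1) (j := i + 1)
    (fun h => Fin.add_one_add_one_ne_self (i - 1) (by simp [← h]))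
    (by simp)
    (fun h => Fin.add_one_add_one_add_one_ne_self hn (i - 1) (by simp [← h]))
  rw [hA.inl_inr_self, hA.inr_inr_self, hA.inl_inr_self, e1, e2,
    Matrix.one_apply_ne (by simp)] at h
  linear_combination h

/-- The walks of length two joining the two vertices of column `i + 1` leave either forwards or
backwards. Their contributions have opposite signs, so the real part of `a * conj b` is the same on
both sides. -/
theorem re_step (hA : IsNormalizedDonut A) (hn : 1 ≤ n) (i) :
    A (inl (i + 1)) (inl (i + 1 + 1)) * conj (A (inl (i + 1)) (inr (i + 1 + 1))) +
      A (inl (i + 1)) (inr (i + 1 + 1)) * conj (A (inl (i + 1)) (inl (i + 1 + 1))) =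
    A (inl i) (inl (i + 1)) * conj (A (inl i) (inr (i + 1))) +
      A (inl i) (inr (i + 1)) * conj (A (inl i) (inl (i + 1))) := by
  have h := hA.sum_inl (i + 1) (inr (i + 1))
  rw [hA.inr_inr_self, add_sub_cancel_right, ← hA.conj_apply (inr (i + 1)) (inl (i + 1 + 1)),
    ← hA.conj_apply (inr (i + 1)) (inr (i + 1 + 1)), hA.inr_inl hn, hA.inr_inr hn, hA.inr_inr hn,
    ← hA.conj_apply (inl i) (inl (i + 1)), ← hA.conj_apply (inr i) (inl (i + 1)),
    hA.inr_inl hn, Matrix.one_apply_ne (by simp)] at h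
  simp only [map_neg] at h
  linear_combination -h

/-- For `t ≥ 5` every walk of length two from column `i` to column `i + 2` passes through column `i
+ 1`. -/
theorem mul_eq_mul (hA : IsNormalizedDonut A) (hn : 2 ≤ n) (i) :
    A (inl i) (inl (i + 1)) * A (inl (i + 1)) (inl (i + 1 + 1)) =
      A (inl i) (inr (i + 1)) * A (inl (i + 1)) (inr (i + 1 + 1)) ∧
    A (inl i) (inl (i + 1)) * A (inl (i + 1)) (inr (i + 1 + 1)) =
      A (inl i) (inr (i + 1)) * A (inl (i + 1)) (inl (i + 1 + 1)) := by
  have hne := Fin.add_one_add_one_ne_self i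
  have h := hA.sum_inl i (inl (i + 1 + 1))
  have k := hA.sum_inl i (inr (i + 1 + 1))
  obtain ⟨e1, e2, e3, e4⟩ := hA.apply_eq_zero_of_ne (i := i) (j := i + 1 + 1) hne.symm
    (by simp) (Fin.add_one_add_one_add_one_ne_self (by omega) i).symm
  obtain ⟨f1, f2, f3, f4⟩ := hA.apply_eq_zero_of_ne (i := i - 1) (j := i + 1 + 1)
    (fun h => Fin.add_one_add_one_add_one_ne_self (by omega) (i - 1) (by simp [← h]))
    (by simpa using hne) (fun h => Fin.add_four_ones_ne_self hn (i - 1) (by simp [← h]))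
  rw [e3, f1, f3, hA.inr_inl (by omega), Matrix.one_apply_ne (by simp [hne.symm])] at h
  rw [e4, f2, f4, hA.inr_inr (by omega), Matrix.one_apply_ne (by simp)] at k
  exact ⟨by linear_combination h, by linear_combination k⟩

/-- The monomial matrix with entries `a i` at the positions `(i, i + 1)`. -/
def _root_.cyclicMonomial (a : Fin (n + 3) → ℂ) : Matrix (Fin (n + 3)) (Fin (n + 3)) ℂ :=
  Matrix.of fun i j => if j = i + 1 then a i else 0

theorem _root_.isWeighingMatrix_cyclicMonomial {a : Fin (n + 3) → ℂ} (ha : ∀ i, ‖a i‖ = 1) :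
    IsWeighingMatrix (cyclicMonomial a) 1 := by
  refine ⟨fun i j => ?_, ?_⟩
  · by_cases h : j = i + 1 <;> simp [cyclicMonomial, h, ha]
  · ext i j
    rw [Matrix.mul_apply, Finset.sum_eq_single (i + 1)]
    · by_cases h : i = j
      · subst h
        simp [cyclicMonomial, mul_conj_self_of_norm_one (ha i)]
      · simp [cyclicMonomial, h]
    · intro k _ hk
      simp [cyclicMonomial, hk]
    · simp

/-- Exchanging `C` with `C*` fixes the diagonal blocks and negates `C - C*`, which absorbs the sign
`ε`. The relations `h2` and `h3` are hypotheses so that the result also serves `t = 3`, where the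
local argument fails. -/
theorem exists_eq_donutMatrix (hA : IsNormalizedDonut A) {ε : ℂ} (hε : ε = 1 ∨ ε = -1)
    (h1 : ∀ i, A (inl i) (inr (i + 1)) = ε * A (inl i) (inl (i + 1)))
    (h2 : ∀ i, A (inr i) (inl (i + 1)) = -ε * A (inl i) (inl (i + 1)))
    (h3 : ∀ i, A (inr i) (inr (i + 1)) = -A (inl i) (inl (i + 1))) :
    ∃ C : Matrix (Fin (n + 3)) (Fin (n + 3)) ℂ, IsWeighingMatrix C 1 ∧ donutMatrix C = A := by
  set D := cyclicMonomial fun i => A (inl i) (inl (i + 1)) with hD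
  have hw : IsWeighingMatrix D 1 := isWeighingMatrix_cyclicMonomial hA.norm_inl_inl
  have key : ∀ i j,
      A (inl i) (inl j) = D i j + D.conjTranspose i j ∧
      A (inl i) (inr j) = ε * (D i j - D.conjTranspose i j) + (1 : Matrix _ _ ℂ) i j ∧
      A (inr i) (inl j) = ε * (D.conjTranspose i j - D i j) + (1 : Matrix _ _ ℂ) i j ∧
      A (inr i) (inr j) = - D i j - D.conjTranspose i j := by
    have hεc : conj ε = ε := by rcases hε with rfl | rfl <;> simp
    intro i j
    simp only [Matrix.conjTranspose_apply, hD, cyclicMonomial, Matrix.of_apply]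
    have hne := Fin.add_one_add_one_ne_self (n := n)
    by_cases c1 : i = j
    · subst c1
      simp [hA.inl_inl_self, hA.inr_inr_self, hA.inl_inr_self, hA.inr_inl_self]
    · by_cases c2 : j = i + 1
      · subst c2
        simp [h1, h2, h3, (hne i).symm]
      · by_cases c3 : i = j + 1
        · subst c3
          rw [← hA.conj_apply (inl j), ← hA.conj_apply (inl j), ← hA.conj_apply (inr j),
            ← hA.conj_apply (inr j), h1, h2, h3]
          simp [(hne j).symm, hεc]
        · obtain ⟨e1, e2, e3, e4⟩ := hA.apply_eq_zero_of_ne c1 c2 c3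
          simp [e1, e2, e3, e4, c1, c2, c3]
  rcases hε with rfl | rfl
  · refine ⟨D, hw, ?_⟩
    ext (i | i) (j | j) <;> obtain ⟨e1, e2, e3, e4⟩ := key i j <;>
      simp [donutMatrix, e1, e2, e3, e4]
  · refine ⟨D.conjTranspose, hw.conjTranspose, ?_⟩
    ext (i | i) (j | j) <;> obtain ⟨e1, e2, e3, e4⟩ := key i j <;>
      simp [donutMatrix, e1, e2, e3, e4] <;> ring

theorem exists_eq_donutMatrix_of_inl_inr (hA : IsNormalizedDonut A) (hn : 1 ≤ n) {ε : ℂ}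
    (hε : ε = 1 ∨ ε = -1) (h : ∀ i, A (inl i) (inr (i + 1)) = ε * A (inl i) (inl (i + 1))) :
    ∃ C : Matrix (Fin (n + 3)) (Fin (n + 3)) ℂ, IsWeighingMatrix C 1 ∧ donutMatrix C = A :=
  hA.exists_eq_donutMatrix hε h (fun i => by rw [hA.inr_inl hn, h, neg_mul]) (hA.inr_inr hn)

theorem exists_eq_donutMatrix_of_two_le (hA : IsNormalizedDonut A) (hn : 2 ≤ n) :
    ∃ C : Matrix (Fin (n + 3)) (Fin (n + 3)) ℂ, IsWeighingMatrix C 1 ∧ donutMatrix C = A := by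
  have ha : ∀ i, A (inl i) (inl (i + 1)) ≠ 0 := fun i h0 => by simpa [h0] using hA.norm_inl_inl i
  have hb : ∀ i, A (inl i) (inr (i + 1)) ≠ 0 := fun i h0 => by simpa [h0] using hA.norm_inl_inr i
  obtain ⟨ε, hε, h0⟩ : ∃ ε : ℂ, (ε = 1 ∨ ε = -1) ∧
      A (inl 0) (inr (0 + 1)) = ε * A (inl 0) (inl (0 + 1)) := by
    obtain ⟨e1, e2⟩ := hA.mul_eq_mul hn 0
    -- The two relations give `a₁ (b₀² - a₀²) = 0`, and `a₁` is a unit.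
    have : (A (inl 0) (inr (0 + 1)) - A (inl 0) (inl (0 + 1))) *
        (A (inl 0) (inr (0 + 1)) + A (inl 0) (inl (0 + 1))) = 0 := by
      refine (mul_eq_zero.1 ?_).resolve_left (ha (0 + 1))
      linear_combination A (inl 0) (inl (0 + 1)) * e1 * (-1) - A (inl 0) (inr (0 + 1)) * e2
    rcases mul_eq_zero.1 this with h | h
    · exact ⟨1, Or.inl rfl, by linear_combination h⟩
    · exact ⟨-1, Or.inr rfl, by linear_combination h⟩
  refine hA.exists_eq_donutMatrix_of_inl_inr (by omega) hε (Fin.forall_of_add_one h0 fun i hi => ?_)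
  refine mul_left_cancel₀ (ha i) ?_
  rw [(hA.mul_eq_mul hn i).2, hi]
  ring

end IsNormalizedDonut

/-! ### Swapping within a column, and the case `t = 4` -/

theorem donutGraph_adj_iff {n : ℕ} {u v : Fin (n + 3) ⊕ Fin (n + 3)} :
    (donutGraph (n + 3)).Adj u v ↔ u ≠ v ∧
      (v.elim id id = u.elim id id + 1 ∨ u.elim id id = v.elim id id + 1 ∨
        u.elim id id = v.elim id id) := by
  rcases u with i | i <;> rcases v with j | j
  · rw [donutGraph_adj_inl_inl]
    by_cases h : i = j <;> simp [h]
  · rw [donutGraph_adj_inl_inr]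
    simp [or_assoc]
  · rw [donutGraph_adj_inr_inl]
    simp [or_assoc]
  · rw [donutGraph_adj_inr_inr]
    by_cases h : i = j <;> simp [h]

theorem donutGraph_adj_swap {n : ℕ} (j : Fin (n + 3)) {u v : Fin (n + 3) ⊕ Fin (n + 3)} :
    (donutGraph (n + 3)).Adj (Equiv.swap (.inl j) (.inr j) u) (Equiv.swap (.inl j) (.inr j) v) ↔
      (donutGraph (n + 3)).Adj u v := by
  have h : ∀ u : Fin (n + 3) ⊕ Fin (n + 3),
      (Equiv.swap (.inl j) (.inr j) u).elim id id = u.elim id id := by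
    intro u
    rw [Equiv.swap_apply_def]
    split_ifs with h1 h2
    · simp [h1]
    · simp [h2]
    · rfl
  rw [donutGraph_adj_iff, donutGraph_adj_iff, h, h, (Equiv.injective _).ne_iff]

namespace IsNormalizedDonut

open Sum

section swap

variable {n : ℕ} {A : Matrix (Fin (n + 3) ⊕ Fin (n + 3)) (Fin (n + 3) ⊕ Fin (n + 3)) ℂ}

/-- Such a swap is the extra symmetry available at `t = 4`: it conjugates the ratios `b / a` of the
two blocks touching column `j` and leaves the others alone. -/
theorem submatrix_swap (hA : IsNormalizedDonut A) (j : Fin (n + 3)) :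
    IsNormalizedDonut
      (A.submatrix (Equiv.swap (inl j) (inr j)) (Equiv.swap (inl j) (inr j))) := by
  refine ⟨⟨fun u v => hA.conj_apply _ _, fun u v h => hA.norm_apply _ _ ?_,
    fun u v h => hA.apply_eq_zero _ _ ?_, ?_⟩, fun i => ?_⟩
  · exact (donutGraph_adj_swap j).2 h
  · exact fun k => h ((donutGraph_adj_swap j).1 k)
  · rw [Matrix.submatrix_mul_equiv, hA.mul_self, Matrix.submatrix_smul, Pi.smul_apply,
      Pi.smul_apply, Matrix.submatrix_one_equiv]
  · by_cases h : i = j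
    · subst h
      simp [hA.inr_inl_self]
    · simp [Equiv.swap_apply_def, h, hA.inl_inr_self]

end swap

variable {A : Matrix (Fin (1 + 3) ⊕ Fin (1 + 3)) (Fin (1 + 3) ⊕ Fin (1 + 3)) ℂ}

/-- Columns `i` and `i + 2` are joined through both `i + 1` and `i + 3`, and the two contributions
must cancel. -/
theorem mul_sub_mul_eq (hA : IsNormalizedDonut A) (i : Fin (1 + 3)) :
    A (inl i) (inl (i + 1)) * A (inl (i + 1)) (inr (i + 2)) -
        A (inl i) (inr (i + 1)) * A (inl (i + 1)) (inl (i + 2)) =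
      conj (A (inl (i + 2)) (inr (i + 3)) * A (inl (i + 3)) (inl i) -
        A (inl (i + 2)) (inl (i + 3)) * A (inl (i + 3)) (inr i)) := by
  have h := hA.sum_inl i (inr (i + 2))
  have e2 : i + 1 + 1 = i + 2 := by rw [add_assoc]; rfl
  have e3 : i + 2 + 1 = i + 3 := by rw [add_assoc]; rfl
  have e0 : i + 3 + 1 = i := by rw [add_assoc]; exact add_zero i
  have e4 : i - 1 = i + 3 := by rw [sub_eq_iff_eq_add, e0]
  have e5 : A (inr i) (inr (i + 2)) = 0 :=
    (hA.apply_eq_zero_of_ne (i := i) (j := i + 2) (by clear * -; revert i; decide)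
      (by clear * -; revert i; decide) (by clear * -; revert i; decide)).2.2.2
  have r1 := hA.inr_inr le_rfl (i + 1)
  have r2 := hA.inr_inl le_rfl (i + 2)
  have r3 := hA.inr_inr le_rfl (i + 2)
  have r4 := hA.inr_inl le_rfl (i + 3)
  rw [e2] at r1
  rw [e3] at r2 r3
  rw [e0] at r4
  rw [e4, e5, r1, ← hA.conj_apply (inl (i + 3)) (inl i), ← hA.conj_apply (inr (i + 3)) (inl i),
    ← hA.conj_apply (inr (i + 2)) (inl (i + 3)), ← hA.conj_apply (inr (i + 2)) (inr (i + 3)),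
    r2, r3, r4, Matrix.one_apply_ne (by simp)] at h
  simp only [map_neg] at h
  simp only [map_sub, map_mul]
  linear_combination h

theorem eq_dStarEight (hA : IsNormalizedDonut A) {c : Circle}
    (a0 : A (inl 0) (inl 1) = 1) (a1 : A (inl 1) (inl 2) = 1) (a2 : A (inl 2) (inl 3) = 1)
    (a3 : A (inl 3) (inl 0) = 1) (b0 : A (inl 0) (inr 1) = c)
    (b1 : A (inl 1) (inr 2) = conj (c : ℂ)) (b2 : A (inl 2) (inr 3) = c)
    (b3 : A (inl 3) (inr 0) = conj (c : ℂ)) :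
    dStarEight c = A.submatrix finSumFinEquiv.symm finSumFinEquiv.symm := by
  have hM : ∀ i j : Fin (1 + 3),
      dStarEight c (Fin.castAdd 4 i) (Fin.castAdd 4 j) = A (inl i) (inl j) ∧
      dStarEight c (Fin.castAdd 4 i) (Fin.natAdd 4 j) = A (inl i) (inr j) ∧
      dStarEight c (Fin.natAdd 4 i) (Fin.castAdd 4 j) = A (inr i) (inl j) ∧
      dStarEight c (Fin.natAdd 4 i) (Fin.natAdd 4 j) = A (inr i) (inr j) := by
    intro i j
    have r0 : A (inr 0) (inl 1) = - c := (hA.inr_inl le_rfl 0).trans (congrArg _ b0)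
    have r1 : A (inr 1) (inl 2) = - conj (c : ℂ) := (hA.inr_inl le_rfl 1).trans (congrArg _ b1)
    have r2 : A (inr 2) (inl 3) = - c := (hA.inr_inl le_rfl 2).trans (congrArg _ b2)
    have r3 : A (inr 3) (inl 0) = - conj (c : ℂ) := (hA.inr_inl le_rfl 3).trans (congrArg _ b3)
    have s0 : A (inr 0) (inr 1) = - 1 := (hA.inr_inr le_rfl 0).trans (congrArg _ a0)
    have s1 : A (inr 1) (inr 2) = - 1 := (hA.inr_inr le_rfl 1).trans (congrArg _ a1)
    have s2 : A (inr 2) (inr 3) = - 1 := (hA.inr_inr le_rfl 2).trans (congrArg _ a2)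
    have s3 : A (inr 3) (inr 0) = - 1 := (hA.inr_inr le_rfl 3).trans (congrArg _ a3)
    by_cases h1 : i = j
    · subst h1
      rw [hA.inl_inl_self, hA.inr_inr_self, hA.inl_inr_self, hA.inr_inl_self]
      fin_cases i <;> exact ⟨rfl, rfl, rfl, rfl⟩
    by_cases h2 : j = i + 1
    · subst h2
      fin_cases i
      · exact ⟨a0.symm, b0.symm, r0.symm, s0.symm⟩
      · exact ⟨a1.symm, b1.symm, r1.symm, s1.symm⟩
      · exact ⟨a2.symm, b2.symm, r2.symm, s2.symm⟩
      · exact ⟨a3.symm, b3.symm, r3.symm, s3.symm⟩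
    by_cases h3 : i = j + 1
    · subst h3
      rw [← hA.conj_apply (inl j), ← hA.conj_apply (inl j), ← hA.conj_apply (inr j),
        ← hA.conj_apply (inr j)]
      fin_cases j
      · exact ⟨by simp [a0, dStarEight], by simp [r0, dStarEight], by simp [b0, dStarEight],
          by simp [s0, dStarEight]⟩
      · exact ⟨by simp [a1, dStarEight], by simp [r1, dStarEight], by simp [b1, dStarEight],
          by simp [s1, dStarEight]⟩
      · exact ⟨by simp [a2, dStarEight], by simp [r2, dStarEight], by simp [b2, dStarEight],
          by simp [s2, dStarEight]⟩
      · exact ⟨by simp [a3, dStarEight], by simp [r3, dStarEight], by simp [b3, dStarEight],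
          by simp [s3, dStarEight]⟩
    · obtain ⟨e1, e2, e3, e4⟩ := hA.apply_eq_zero_of_ne h1 h2 h3
      rw [e1, e2, e3, e4]
      fin_cases i <;> fin_cases j <;> first
        | exact absurd rfl h1
        | exact absurd rfl h2
        | exact absurd rfl h3
        | exact ⟨rfl, rfl, rfl, rfl⟩
  ext u v
  obtain ⟨u, rfl⟩ := (finSumFinEquiv (m := 1 + 3) (n := 1 + 3)).surjective u
  obtain ⟨v, rfl⟩ := (finSumFinEquiv (m := 1 + 3) (n := 1 + 3)).surjective v
  rw [Matrix.submatrix_apply, Equiv.symm_apply_apply, Equiv.symm_apply_apply]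
  rcases u with i | i <;> rcases v with j | j
  · exact (hM i j).1
  · exact (hM i j).2.1
  · exact (hM i j).2.2.1
  · exact (hM i j).2.2.2

theorem switchEquivalent_dStarEight (hA : IsNormalizedDonut A) {w : ℂ} (hw : ‖w‖ = 1)
    (hw' : w ≠ conj w) (b0 : A (inl 0) (inr 1) = w * A (inl 0) (inl 1))
    (b1 : A (inl 1) (inr 2) = conj w * A (inl 1) (inl 2))
    (b2 : A (inl 2) (inr 3) = w * A (inl 2) (inl 3))
    (b3 : A (inl 3) (inr 0) = conj w * A (inl 3) (inl 0)) :
    ∃ c : Circle, SwitchEquivalent A (dStarEight c) := by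
  have n0 : ‖A (inl 0) (inl 1)‖ = 1 := hA.norm_inl_inl 0
  have n1 : ‖A (inl 1) (inl 2)‖ = 1 := hA.norm_inl_inl 1
  have n2 : ‖A (inl 2) (inl 3)‖ = 1 := hA.norm_inl_inl 2
  have hprod :
      A (inl 0) (inl 1) * A (inl 1) (inl 2) * A (inl 2) (inl 3) * A (inl 3) (inl 0) = 1 := by
    have n3 : ‖A (inl 3) (inl 0)‖ = 1 := hA.norm_inl_inl 3
    have h : A (inl 0) (inl 1) * A (inl 1) (inr 2) - A (inl 0) (inr 1) * A (inl 1) (inl 2) =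
        conj (A (inl 2) (inr 3) * A (inl 3) (inl 0) - A (inl 2) (inl 3) * A (inl 3) (inr 0)) :=
      hA.mul_sub_mul_eq 0
    rw [b0, b1, b2, b3] at h
    simp only [map_sub, map_mul, Complex.conj_conj] at h
    -- Both sides of `h` carry the factor `conj w - w`, which is nonzero.
    have h' : A (inl 0) (inl 1) * A (inl 1) (inl 2) =
        conj (A (inl 2) (inl 3)) * conj (A (inl 3) (inl 0)) := by
      refine mul_left_cancel₀ (sub_ne_zero.2 hw') ?_
      linear_combination -h
    rw [h']
    linear_combination conj (A (inl 3) (inl 0)) * A (inl 3) (inl 0) *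
      conj_mul_self_of_norm_one n2 + conj_mul_self_of_norm_one n3
  -- Conjugated partial products along the path `0, 1, 2, 3` turn three cycle gains into 1; `hprod`
  -- handles the closing edge.
  let σ : Fin (1 + 3) → ℂ := ![1, conj (A (inl 0) (inl 1)),
    conj (A (inl 0) (inl 1) * A (inl 1) (inl 2)),
    conj (A (inl 0) (inl 1) * A (inl 1) (inl 2) * A (inl 2) (inl 3))]
  have hσ : ∀ i, ‖σ i‖ = 1 := by
    intro i
    fin_cases i <;> simp [σ, n0, n1, n2]
  have hs : ∀ u, ‖Sum.elim σ σ u‖ = 1 := by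
    rintro (i | i) <;> simp [hσ]
  set B := Matrix.of fun u v => conj (Sum.elim σ σ u) * A u v * Sum.elim σ σ v with hB
  have hAB : SwitchEquivalent A B := SwitchEquivalent.of_switch A _ hs
  have hN : IsNormalizedDonut B := by
    refine ⟨hA.switch hs, fun i => ?_⟩
    simp [hB, hA.inl_inr_self, conj_mul_self_of_norm_one (hσ i)]
  have m0 := conj_mul_self_of_norm_one n0
  have m1 := conj_mul_self_of_norm_one n1
  have m2 := conj_mul_self_of_norm_one n2
  have a0 : B (inl 0) (inl 1) = 1 := by
    simp only [hB, σ, Matrix.of_apply, Sum.elim_inl, Matrix.cons_val, map_one]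
    linear_combination m0
  have a1 : B (inl 1) (inl 2) = 1 := by
    simp only [hB, σ, Matrix.of_apply, Sum.elim_inl, Matrix.cons_val, map_mul, Complex.conj_conj]
    linear_combination conj (A (inl 1) (inl 2)) * A (inl 1) (inl 2) * m0 + m1
  have a2 : B (inl 2) (inl 3) = 1 := by
    simp only [hB, σ, Matrix.of_apply, Sum.elim_inl, Matrix.cons_val, map_mul, Complex.conj_conj]
    linear_combination conj (A (inl 1) (inl 2)) * A (inl 1) (inl 2) * conj (A (inl 2) (inl 3)) *
      A (inl 2) (inl 3) * m0 + conj (A (inl 2) (inl 3)) * A (inl 2) (inl 3) * m1 + m2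
  have a3 : B (inl 3) (inl 0) = 1 := by
    simp only [hB, σ, Matrix.of_apply, Sum.elim_inl, Matrix.cons_val, map_mul, Complex.conj_conj]
    linear_combination hprod
  have c0 : B (inl 0) (inr 1) = w := by
    simp only [hB, σ, Matrix.of_apply, Sum.elim_inl, Sum.elim_inr, b0] at a0 ⊢
    linear_combination w * a0
  have c1 : B (inl 1) (inr 2) = conj w := by
    simp only [hB, σ, Matrix.of_apply, Sum.elim_inl, Sum.elim_inr, b1] at a1 ⊢
    linear_combination conj w * a1
  have c2 : B (inl 2) (inr 3) = w := by
    simp only [hB, σ, Matrix.of_apply, Sum.elim_inl, Sum.elim_inr, b2] at a2 ⊢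
    linear_combination w * a2
  have c3 : B (inl 3) (inr 0) = conj w := by
    simp only [hB, σ, Matrix.of_apply, Sum.elim_inl, Sum.elim_inr, b3] at a3 ⊢
    linear_combination conj w * a3
  refine ⟨⟨w, mem_sphere_zero_iff_norm.2 hw⟩, hAB.trans ?_⟩
  rw [hN.eq_dStarEight (c := ⟨w, mem_sphere_zero_iff_norm.2 hw⟩) a0 a1 a2 a3 c0 c1 c2 c3]
  exact SwitchEquivalent.of_submatrix B finSumFinEquiv.symm

theorem exists_switchEquivalent_of_four (hA : IsNormalizedDonut A) :
    (∃ C : Matrix (Fin (1 + 3)) (Fin (1 + 3)) ℂ, IsWeighingMatrix C 1 ∧ donutMatrix C = A) ∨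
      ∃ c : Circle, SwitchEquivalent A (dStarEight c) := by
  set z : Fin (1 + 3) → ℂ := fun i => A (inl i) (inr (i + 1)) * conj (A (inl i) (inl (i + 1)))
    with hz
  have hzn : ∀ i, ‖z i‖ = 1 := fun i => by
    rw [hz, norm_mul, RCLike.norm_conj, hA.norm_inl_inr, hA.norm_inl_inl, one_mul]
  have hzb : ∀ i, A (inl i) (inr (i + 1)) = z i * A (inl i) (inl (i + 1)) := fun i => by
    rw [hz, mul_assoc, conj_mul_self_of_norm_one (hA.norm_inl_inl i), mul_one]
  have hre : ∀ i, z i + conj (z i) = z 0 + conj (z 0) := by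
    refine Fin.forall_of_add_one rfl fun i hi => ?_
    have := hA.re_step le_rfl i
    simp only [hz, map_mul, Complex.conj_conj] at hi ⊢
    linear_combination hi + this
  -- Unit numbers with equal real parts are equal or conjugate.
  have hor : ∀ i, z i = z 0 ∨ z i = conj (z 0) := by
    intro i
    have : (z i - z 0) * (z i - conj (z 0)) = 0 := by
      linear_combination z i * hre i - mul_conj_self_of_norm_one (hzn i) +
        mul_conj_self_of_norm_one (hzn 0)
    exact (mul_eq_zero.1 this).imp sub_eq_zero.1 sub_eq_zero.1
  by_cases hw : z 0 = conj (z 0)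
  · left
    have h1 : (z 0 - 1) * (z 0 + 1) = 0 := by
      have := mul_conj_self_of_norm_one (hzn 0)
      rw [← hw] at this
      linear_combination this
    refine hA.exists_eq_donutMatrix_of_inl_inr le_rfl (ε := z 0)
      ((mul_eq_zero.1 h1).imp sub_eq_zero.1 eq_neg_of_add_eq_zero_left) fun i => ?_
    rw [hzb]
    rcases hor i with h | h <;> rw [h]
    rw [← hw]
  right
  have ha : ∀ i, A (inl i) (inl (i + 1)) ≠ 0 := fun i h0 => by simpa [h0] using hA.norm_inl_inl i
  have b0 : A (inl 0) (inr 1) = z 0 * A (inl 0) (inl 1) := hzb 0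
  have b1 : A (inl 1) (inr 2) = z 1 * A (inl 1) (inl 2) := hzb 1
  have b2 : A (inl 2) (inr 3) = z 2 * A (inl 2) (inl 3) := hzb 2
  have b3 : A (inl 3) (inr 0) = z 3 * A (inl 3) (inl 0) := hzb 3
  have a0 : A (inl 0) (inl 1) ≠ 0 := ha 0
  have a1 : A (inl 1) (inl 2) ≠ 0 := ha 1
  have a2 : A (inl 2) (inl 3) ≠ 0 := ha 2
  have a3 : A (inl 3) (inl 0) ≠ 0 := ha 3
  have hpar : z 1 = z 0 ↔ z 2 = z 3 := by
    have h : A (inl 0) (inl 1) * A (inl 1) (inr 2) - A (inl 0) (inr 1) * A (inl 1) (inl 2) =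
        conj (A (inl 2) (inr 3) * A (inl 3) (inl 0) - A (inl 2) (inl 3) * A (inl 3) (inr 0)) :=
      hA.mul_sub_mul_eq 0
    rw [b0, b1, b2, b3] at h
    have h' : (z 1 - z 0) * (A (inl 0) (inl 1) * A (inl 1) (inl 2)) =
        conj ((z 2 - z 3) * (A (inl 2) (inl 3) * A (inl 3) (inl 0))) := by
      simp only [map_sub, map_mul] at h ⊢
      linear_combination h
    constructor
    · intro k
      rw [k, sub_self, zero_mul, eq_comm, map_eq_zero] at h'
      simpa [a2, a3, sub_eq_zero] using h'
    · intro k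
      rw [k, sub_self, zero_mul, map_zero] at h'
      simpa [a0, a1, sub_eq_zero] using h'
  have hw' : conj (z 0) ≠ z 0 := Ne.symm hw
  have m : z 0 * conj (z 0) = 1 := mul_conj_self_of_norm_one (hzn 0)
  have m' : conj (z 0) * z 0 = 1 := conj_mul_self_of_norm_one (hzn 0)
  have r2 : A (inr 2) (inl 3) = -A (inl 2) (inr 3) := hA.inr_inl le_rfl 2
  have r3 : A (inr 3) (inl 0) = -A (inl 3) (inr 0) := hA.inr_inl le_rfl 3
  have s2 : A (inr 2) (inr 3) = -A (inl 2) (inl 3) := hA.inr_inr le_rfl 2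
  have s3 : A (inr 3) (inr 0) = -A (inl 3) (inl 0) := hA.inr_inr le_rfl 3
  -- The parity condition `hpar` eliminates four of the eight patterns. Swapping in column 2
  -- conjugates `z 1` and `z 2`; in column 3, `z 2` and `z 3`. This brings each remaining pattern to
  -- the alternating one.
  rcases hor 1 with h1 | h1 <;> rcases hor 2 with h2 | h2 <;> rcases hor 3 with h3 | h3 <;>
    rw [h1, h2, h3] at hpar <;> simp only [hw, hw', true_iff, iff_true] at hpar <;>
    rw [h1] at b1 <;> rw [h2] at b2 <;> rw [h3] at b3
  · have hB := (hA.submatrix_swap 2).submatrix_swap 3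
    obtain ⟨c, hc⟩ := hB.switchEquivalent_dStarEight (hzn 0) hw (by simpa [Equiv.swap_apply_def])
      (by simp [Equiv.swap_apply_def, b1, m', ← mul_assoc])
      (by simp [Equiv.swap_apply_def, b2, r2, s2])
      (by simp [Equiv.swap_apply_def, r3, s3, b3, m', ← mul_assoc])
    exact ⟨c, (SwitchEquivalent.of_submatrix _ _).trans
      ((SwitchEquivalent.of_submatrix _ _).trans hc)⟩
  · have hB := hA.submatrix_swap 2
    obtain ⟨c, hc⟩ := hB.switchEquivalent_dStarEight (hzn 0) hw (by simpa [Equiv.swap_apply_def])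
      (by simp [Equiv.swap_apply_def, b1, m', ← mul_assoc])
      (by simp [Equiv.swap_apply_def, b2, r2, s2, m, ← mul_assoc])
      (by simp [Equiv.swap_apply_def, b3])
    exact ⟨c, (SwitchEquivalent.of_submatrix _ _).trans hc⟩
  · exact hA.switchEquivalent_dStarEight (hzn 0) hw b0 b1 b2 b3
  · have hB := hA.submatrix_swap 3
    obtain ⟨c, hc⟩ := hB.switchEquivalent_dStarEight (hzn 0) hw (by simpa [Equiv.swap_apply_def])
      (by simp [Equiv.swap_apply_def, b1])
      (by simp [Equiv.swap_apply_def, b2, m, ← mul_assoc])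
      (by simp [Equiv.swap_apply_def, b3, r3, s3, m', ← mul_assoc])
    exact ⟨c, (SwitchEquivalent.of_submatrix _ _).trans hc⟩

end IsNormalizedDonut

/-! ### Vanishing sums of unit complex numbers -/

/-- In elementary symmetric functions, `(a + b)(a + c)(a + d) = a² e₁ + e₃`, and `e₃ = e₄ * conj e₁`
for unit numbers; both terms vanish with `e₁`. -/
theorem opposite_pairs_of_sum_eq_zero {a b c d : ℂ} (ha : ‖a‖ = 1) (hb : ‖b‖ = 1) (hc : ‖c‖ = 1)
    (hd : ‖d‖ = 1) (h : a + b + c + d = 0) :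
    (a + b = 0 ∧ c + d = 0) ∨ (a + c = 0 ∧ b + d = 0) ∨ (a + d = 0 ∧ b + c = 0) := by
  have h' : conj a + conj b + conj c + conj d = 0 := by
    rw [← map_add, ← map_add, ← map_add, h, map_zero]
  have key : (a + b) * ((a + c) * (a + d)) = 0 := by
    linear_combination a ^ 2 * h + a * b * c * d * h' -
      b * c * d * mul_conj_self_of_norm_one ha - a * c * d * mul_conj_self_of_norm_one hb -
      a * b * d * mul_conj_self_of_norm_one hc - a * b * c * mul_conj_self_of_norm_one hd
  rcases mul_eq_zero.1 key with k | k
  · exact Or.inl ⟨k, by linear_combination h - k⟩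
  rcases mul_eq_zero.1 k with k | k
  · exact Or.inr (Or.inl ⟨k, by linear_combination h - k⟩)
  · exact Or.inr (Or.inr ⟨k, by linear_combination h - k⟩)

/-- Here `q` is minus the real part of `x`. A real part of modulus one leaves no imaginary part. -/
theorem eq_one_or_neg_one_of_add_conj {x q : ℂ} (hx : ‖x‖ = 1) (hq : ‖q‖ = 1)
    (h : x + conj x + 2 * q = 0) : (x = 1 ∨ x = -1) ∧ q = -x := by
  have hx' := mul_conj_self_of_norm_one hx
  have hqx : q = -x := by
    have hc : conj q = q := by
      have h' := congrArg conj h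
      simp only [map_add, map_mul, Complex.conj_conj, map_zero, Complex.conj_ofNat] at h'
      linear_combination (h' - h) / 2
    have hq' := mul_conj_self_of_norm_one hq
    rw [hc] at hq'
    have : (q + x) ^ 2 = 0 := by linear_combination x * h + hq' - hx'
    exact eq_neg_of_add_eq_zero_left (pow_eq_zero_iff two_ne_zero |>.1 this)
  refine ⟨?_, hqx⟩
  have : (x - 1) * (x + 1) = 0 := by
    rw [hqx] at h
    linear_combination hx' - x * h
  exact (mul_eq_zero.1 this).imp sub_eq_zero.1 eq_neg_of_add_eq_zero_left

/-- Strict convexity of the disc; the parallelogram law gives `|u - v|² = 0`. -/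
theorem eq_of_add_eq_two_mul {u v x : ℂ} (hu : ‖u‖ = 1) (hv : ‖v‖ = 1) (hx : ‖x‖ = 1)
    (h : u + v = 2 * x) : u = x ∧ v = x := by
  have hu' := mul_conj_self_of_norm_one hu
  have hv' := mul_conj_self_of_norm_one hv
  have hx' := mul_conj_self_of_norm_one hx
  have h' := congrArg conj h
  simp only [map_add, map_mul, Complex.conj_ofNat] at h'
  have huv : (u - v) * conj (u - v) = 0 := by
    simp only [map_sub]
    linear_combination 2 * hu' + 2 * hv' - (conj u + conj v) * h - 2 * x * h' - 4 * hx'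
  have huv : u = v := by
    rcases mul_eq_zero.1 huv with k | k
    · exact sub_eq_zero.1 k
    · exact sub_eq_zero.1 ((map_eq_zero _).1 k)
  subst huv
  have : u = x := by linear_combination h / 2
  exact ⟨this, this⟩

/-! ### The case `t = 3`: conference matrices of order 6 -/

/-- A Hermitian complex conference matrix of order `6` whose first row is constant off the
diagonal. -/
structure IsNormalizedConference (A : Matrix (Fin 6) (Fin 6) ℂ) : Prop where
  conj_apply : ∀ i j, conj (A i j) = A j i
  norm_apply : ∀ i j, i ≠ j → ‖A i j‖ = 1
  apply_self : ∀ i, A i i = 0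
  mul_self : A * A = (5 : ℂ) • (1 : Matrix (Fin 6) (Fin 6) ℂ)
  zero_apply : ∀ i, i ≠ 0 → A 0 i = 1

/-- `A` is switching equivalent to one of the matrices `donutMatrix C` of order `6`. -/
def IsDonutEquivalent {V : Type*} (A : Matrix V V ℂ) : Prop :=
  ∃ C : Matrix (Fin 3) (Fin 3) ℂ, IsWeighingMatrix C 1 ∧ SwitchEquivalent A (donutMatrix C)

theorem IsDonutEquivalent.of_switchEquivalent {V W : Type*} {A : Matrix V V ℂ} {B : Matrix W W ℂ}
    (hAB : SwitchEquivalent A B) (hB : IsDonutEquivalent B) : IsDonutEquivalent A := by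
  obtain ⟨C, hC, h⟩ := hB
  exact ⟨C, hC, hAB.trans h⟩

namespace IsNormalizedConference

variable {A : Matrix (Fin 6) (Fin 6) ℂ}

theorem apply_zero (hA : IsNormalizedConference A) (i : Fin 6) (hi : i ≠ 0) : A i 0 = 1 := by
  rw [← hA.conj_apply, hA.zero_apply i hi, map_one]

theorem sum_eq_zero (hA : IsNormalizedConference A) (i j : Fin 6) (hij : i ≠ j) :
    A i 0 * A 0 j + A i 1 * A 1 j + A i 2 * A 2 j + A i 3 * A 3 j + A i 4 * A 4 j +
      A i 5 * A 5 j = 0 := by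
  have h := congrFun (congrFun hA.mul_self i) j
  rw [Matrix.mul_apply, Fin.sum_univ_six] at h
  simpa [hij] using h

theorem row_sum (hA : IsNormalizedConference A) (i : Fin 6) (hi : i ≠ 0) :
    A i 1 + A i 2 + A i 3 + A i 4 + A i 5 = 0 := by
  have h := hA.sum_eq_zero i 0 hi
  rw [hA.apply_self, hA.apply_zero 1 (by decide), hA.apply_zero 2 (by decide),
    hA.apply_zero 3 (by decide), hA.apply_zero 4 (by decide), hA.apply_zero 5 (by decide)] at h
  linear_combination h

theorem submatrix (hA : IsNormalizedConference A) {v : Fin 6 → Fin 6}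
    (hv : Function.Injective v) (h0 : v 0 = 0) : IsNormalizedConference (A.submatrix v v) := by
  refine ⟨fun i j => hA.conj_apply _ _, fun i j h => hA.norm_apply _ _ (hv.ne h),
    fun i => hA.apply_self _, ?_, fun i hi => ?_⟩
  · have := Matrix.submatrix_mul_equiv A A v
      (Equiv.ofBijective v (Finite.injective_iff_bijective.1 hv)) v
    rw [Equiv.coe_ofBijective] at this
    rw [this, hA.mul_self, Matrix.submatrix_smul, Pi.smul_apply, Pi.smul_apply,
      Matrix.submatrix_one _ hv]
  · rw [Matrix.submatrix_apply, h0]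
    exact hA.zero_apply _ fun k => hi (hv (k.trans h0.symm))

theorem isDonutEquivalent_of_submatrix {v : Fin 6 → Fin 6} (hv : Function.Injective v)
    (h : IsDonutEquivalent (A.submatrix v v)) : IsDonutEquivalent A :=
  h.of_switchEquivalent (SwitchEquivalent.of_submatrix A
      (Equiv.ofBijective v (Finite.injective_iff_bijective.1 hv)))

theorem isDonutEquivalent_of_row_eq_one (hA : IsNormalizedConference A) (h12 : A 1 2 = 1)
    (h13 : A 1 3 = 1) (h14 : A 1 4 = -1) (h15 : A 1 5 = -1) (h23 : A 2 3 = -1) :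
    IsDonutEquivalent A := by
  have h21 : A 2 1 = 1 := by rw [← hA.conj_apply, h12, map_one]
  have h31 : A 3 1 = 1 := by rw [← hA.conj_apply, h13, map_one]
  have h41 : A 4 1 = -1 := by rw [← hA.conj_apply, h14, map_neg, map_one]
  have h51 : A 5 1 = -1 := by rw [← hA.conj_apply, h15, map_neg, map_one]
  have h32 : A 3 2 = -1 := by rw [← hA.conj_apply, h23, map_neg, map_one]
  have e4 := hA.sum_eq_zero 0 4 (by decide)
  have e5 := hA.sum_eq_zero 0 5 (by decide)
  have f4 := hA.sum_eq_zero 1 4 (by decide)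
  simp only [hA.apply_self, hA.zero_apply 1 (by decide), hA.zero_apply 2 (by decide),
    hA.zero_apply 3 (by decide), hA.zero_apply 4 (by decide), hA.zero_apply 5 (by decide),
    hA.apply_zero 1 (by decide), h12, h13, h14, h15] at e4 e5 f4
  have r2 := hA.row_sum 2 (by decide)
  rw [h21, h23, hA.apply_self] at r2
  have h54 : A 5 4 = 1 := by linear_combination (e4 - f4) / 2
  have h45 : A 4 5 = 1 := by rw [← hA.conj_apply, h54, map_one]
  have h34 : A 3 4 = -A 2 4 := by linear_combination e4 - h54
  have h25 : A 2 5 = -A 2 4 := by linear_combination r2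
  have h35 : A 3 5 = A 2 4 := by linear_combination e5 - h25 - h45
  -- The columns will be the pairs `01`, `23`, `45`. Negating vertex 3 turns the gain `A 2 3 = -1`
  -- into 1, as normalization demands.
  let s : Fin 6 → ℂ := ![1, 1, 1, -1, 1, 1]
  have hs : ∀ u, ‖s u‖ = 1 := by
    intro u
    fin_cases u <;> simp [s]
  let B : Matrix (Fin 6) (Fin 6) ℂ := Matrix.of fun u v => conj (s u) * A u v * s v
  have hAB : SwitchEquivalent A B := SwitchEquivalent.of_switch A s hs
  let f : Fin (0 + 3) ⊕ Fin (0 + 3) → Fin 6 := Sum.elim ![0, 2, 4] ![1, 3, 5]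
  have hf : Function.Bijective f := by decide
  have hadj : ∀ u v : Fin (0 + 3) ⊕ Fin (0 + 3), (donutGraph (0 + 3)).Adj u v ↔ u ≠ v := by
    intro u v
    rw [donutGraph_adj_iff]
    revert u v
    decide
  -- `SwitchEquivalent.mul_self` transfers the square from target to source, so the inverse
  -- switching is needed; `s` has entries `±1` and is its own inverse.
  have hBA : SwitchEquivalent B A := by
    refine ⟨s, Equiv.refl _, hs, fun u v => ?_⟩
    have hss : ∀ u, s u * s u = 1 ∧ conj (s u) = s u := by
      intro u
      fin_cases u <;> simp [s]
    simp only [B, Equiv.refl_apply, Matrix.of_apply, (hss _).2]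
    linear_combination (-A u v * (s v * s v)) * (hss u).1 - A u v * (hss v).1
  have hBs := hBA.mul_self hA.mul_self
  have hN : IsNormalizedDonut (B.submatrix f f) := by
    refine ⟨⟨fun u v => ?_, fun u v h => ?_, fun u v h => ?_, ?_⟩, fun i => ?_⟩
    · simp only [B, Matrix.submatrix_apply, Matrix.of_apply, map_mul, Complex.conj_conj,
        hA.conj_apply]
      ring
    · have := hf.1.ne ((hadj u v).1 h)
      simp [B, hs, hA.norm_apply _ _ this]
    · have : u = v := by simpa using (hadj u v).not.1 h
      simp [B, this, hA.apply_self]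
    · have := Matrix.submatrix_mul_equiv B B f (Equiv.ofBijective f hf) f
      rw [Equiv.coe_ofBijective] at this
      rw [this, hBs, Matrix.submatrix_smul, Pi.smul_apply, Pi.smul_apply,
        Matrix.submatrix_one _ hf.1]
    · fin_cases i <;> simp [B, f, s, hA.zero_apply, h23, h45]
  obtain ⟨C, hC, hCB⟩ := hN.exists_eq_donutMatrix (ε := -1) (Or.inr rfl)
    (fun i => by fin_cases i <;> simp [B, f, s, hA.zero_apply, hA.apply_zero, *])
    (fun i => by fin_cases i <;> simp [B, f, s, hA.zero_apply, hA.apply_zero, *])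
    (fun i => by fin_cases i <;> simp [B, f, s, hA.zero_apply, hA.apply_zero, *])
  refine ⟨C, hC, ?_⟩
  rw [hCB]
  exact hAB.trans (SwitchEquivalent.of_submatrix B (Equiv.ofBijective f hf))

/-- With `x = A 1 2`, orthogonality of rows 1 and 2 combined with the sum of row 2 gives `x + conj x
+ 2 * A 2 3 = 0`, so `x = ±1`. -/
theorem isDonutEquivalent_of_row_eq (hA : IsNormalizedConference A) (h13 : A 1 3 = A 1 2)
    (h14 : A 1 4 = -A 1 2) (h15 : A 1 5 = -A 1 2) : IsDonutEquivalent A := by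
  have hsum := hA.sum_eq_zero 2 1 (by decide)
  have hrow := hA.row_sum 2 (by decide)
  have c1 := hA.conj_apply 1 2
  have h31 := hA.conj_apply 1 3
  have h41 := hA.conj_apply 1 4
  have h51 := hA.conj_apply 1 5
  rw [h13] at h31
  rw [h14, map_neg] at h41
  rw [h15, map_neg] at h51
  rw [hA.apply_zero 2 (by decide), hA.zero_apply 1 (by decide), hA.apply_self 1, hA.apply_self 2,
    ← h31, ← h41, ← h51] at hsum
  rw [hA.apply_self, ← c1] at hrow
  have hn := mul_conj_self_of_norm_one (hA.norm_apply 1 2 (by decide))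
  obtain ⟨h, h23⟩ := eq_one_or_neg_one_of_add_conj (x := A 1 2) (q := A 2 3)
    (hA.norm_apply _ _ (by decide)) (hA.norm_apply _ _ (by decide)) (by
      linear_combination A 1 2 * hsum + hrow + (A 2 4 + A 2 5 - A 2 3) * hn)
  rcases h with h | h
  · refine hA.isDonutEquivalent_of_row_eq_one h ?_ ?_ ?_ ?_
    · rw [h13, h]
    · rw [h14, h]
    · rw [h15, h]
    · rw [h23, h]
  · have hv : Function.Injective (![0, 1, 4, 5, 2, 3] : Fin 6 → Fin 6) := by decide
    have h45 : A 4 5 = -1 := by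
      have hrow4 := hA.row_sum 4 (by decide)
      have hsum4 := hA.sum_eq_zero 4 1 (by decide)
      rw [hA.apply_zero 4 (by decide), hA.zero_apply 1 (by decide), hA.apply_self 1,
        hA.apply_self 4, ← c1, ← h31, ← h41, ← h51, h] at hsum4
      rw [hA.apply_self, ← h41, h] at hrow4
      simp only [map_neg, map_one] at hrow4 hsum4
      linear_combination (hrow4 + hsum4) / 2
    refine isDonutEquivalent_of_submatrix hv
      ((hA.submatrix hv rfl).isDonutEquivalent_of_row_eq_one ?_ ?_ ?_ ?_ h45)
    · simp [h14, h]
    · simp [h15, h]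
    · simp [h]
    · simp [h13, h]

theorem isDonutEquivalent_of_injective (hA : IsNormalizedConference A) {v : Fin 6 → Fin 6}
    (hv : Function.Injective v) (h0 : v 0 = 0) (h3 : A (v 1) (v 3) = A (v 1) (v 2))
    (h4 : A (v 1) (v 4) = -A (v 1) (v 2)) (h5 : A (v 1) (v 5) = -A (v 1) (v 2)) :
    IsDonutEquivalent A :=
  isDonutEquivalent_of_submatrix hv ((hA.submatrix hv h0).isDonutEquivalent_of_row_eq h3 h4 h5)

/-- Write row 1 as `x, -x, y, -y`. Each way of pairing off row 2 makes some row two equal entries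
and their two negatives: row 3, row 1, and in the last pairing row 1 or row 4. -/
theorem isDonutEquivalent_of_neg (hA : IsNormalizedConference A) (h13 : A 1 3 = -A 1 2)
    (h15 : A 1 5 = -A 1 4) (h24 : A 2 4 = -A 1 4)
    (h : A 1 2 * conj (A 2 3) = -A 1 4 * conj (A 2 5)) : IsDonutEquivalent A := by
  have n12 := hA.norm_apply 1 2 (by decide)
  have n14 := hA.norm_apply 1 4 (by decide)
  have m12 := mul_conj_self_of_norm_one n12
  have m14 := mul_conj_self_of_norm_one n14
  have c21 := hA.conj_apply 1 2
  have c31 := hA.conj_apply 1 3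
  have c41 := hA.conj_apply 1 4
  have c32 := hA.conj_apply 2 3
  have c42 := hA.conj_apply 2 4
  have r2 := hA.row_sum 2 (by decide)
  have r3 := hA.row_sum 3 (by decide)
  have r4 := hA.row_sum 4 (by decide)
  rw [hA.apply_self] at r2 r3 r4
  rcases opposite_pairs_of_sum_eq_zero (hA.norm_apply 2 1 (by decide))
    (hA.norm_apply 2 3 (by decide)) (hA.norm_apply 2 4 (by decide))
    (hA.norm_apply 2 5 (by decide)) (by linear_combination r2) with
    ⟨k1, k2⟩ | ⟨k1, k2⟩ | ⟨k1, k2⟩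
  · have h23 : A 2 3 = -conj (A 1 2) := by linear_combination k1 + c21
    have h25 : A 2 5 = A 1 4 := by linear_combination k2 - h24
    rw [h23, h25, map_neg, Complex.conj_conj] at h
    have hx : A 1 2 = conj (A 1 2) := by
      linear_combination conj (A 1 2) * (m14 - h) - A 1 2 * m12
    have h31 : A 3 1 = -A 1 2 := by rw [← c31, h13, map_neg, ← hx]
    have h32 : A 3 2 = -A 1 2 := by rw [← c32, h23, map_neg, Complex.conj_conj]
    obtain ⟨h34, h35⟩ := eq_of_add_eq_two_mul (hA.norm_apply 3 4 (by decide))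
      (hA.norm_apply 3 5 (by decide)) n12 (by linear_combination r3 - h31 - h32)
    exact hA.isDonutEquivalent_of_injective (v := ![0, 3, 1, 2, 4, 5]) (by decide) rfl
      (by simp [h31, h32]) (by simp [h31, h34]) (by simp [h31, h35])
  · have h25 : A 2 5 = -A 2 3 := by linear_combination k2
    have h12 : A 1 2 = A 1 4 := by
      have m23 := conj_mul_self_of_norm_one (hA.norm_apply 2 3 (by decide))
      rw [h25, map_neg] at h
      linear_combination A 2 3 * h - (A 1 2 - A 1 4) * m23
    exact hA.isDonutEquivalent_of_injective (v := ![0, 1, 2, 4, 3, 5]) (by decide) rfl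
      (by simp [h12]) (by simp [h13]) (by simp [h15, h12])
  · have h25 : A 2 5 = -conj (A 1 2) := by linear_combination k1 + c21
    have h23 : A 2 3 = A 1 4 := by linear_combination k2 - h24
    rw [h25, h23, map_neg, Complex.conj_conj] at h
    have hy : conj (A 1 4) = A 1 4 := by
      linear_combination conj (A 1 2) * h - (conj (A 1 4) - A 1 4) * m12
    have hs := hA.sum_eq_zero 1 5 (by decide)
    have hs0 := hA.sum_eq_zero 0 5 (by decide)
    simp only [hA.apply_self, hA.zero_apply 1 (by decide), hA.zero_apply 2 (by decide),
      hA.zero_apply 3 (by decide), hA.zero_apply 4 (by decide), hA.zero_apply 5 (by decide),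
      hA.apply_zero 1 (by decide), h13, h15, h25] at hs hs0
    have hrel : A 1 4 * A 4 5 = A 1 2 * A 3 5 := by linear_combination hs + m12
    rw [hy] at m14
    have caseA : A 1 4 = A 1 2 → IsDonutEquivalent A := fun e =>
      hA.isDonutEquivalent_of_injective (v := ![0, 1, 2, 4, 3, 5]) (by decide) rfl
        (by simp [e]) (by simp [h13]) (by simp [h15, e])
    have caseB : A 1 4 = -A 1 2 → IsDonutEquivalent A := fun e =>
      hA.isDonutEquivalent_of_injective (v := ![0, 1, 2, 5, 3, 4]) (by decide) rfl
        (by simp [h15, e]) (by simp [h13]) (by simp [e])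
    -- Now `y` is real and column 5 is paired off. The first two pairings force `x = ±y`, so row 1
    -- has the wanted shape; the third gives row 4.
    rcases opposite_pairs_of_sum_eq_zero (hA.norm_apply 1 5 (by decide))
      (hA.norm_apply 2 5 (by decide)) (hA.norm_apply 3 5 (by decide))
      (hA.norm_apply 4 5 (by decide)) (by linear_combination hs0 + h15 + h25) with
      ⟨k3, k4⟩ | ⟨k3, k4⟩ | ⟨k3, k4⟩
    · refine caseB ?_
      have e : A 1 4 = -conj (A 1 2) := by linear_combination h15 + h25 - k3
      have e' := congrArg conj e
      rwa [hy, map_neg, Complex.conj_conj] at e'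
    · have h35 : A 3 5 = A 1 4 := by linear_combination k3 - h15
      have h45 : A 4 5 = conj (A 1 2) := by linear_combination k4 - h25
      have hx : A 1 2 = conj (A 1 2) := by
        rw [h35, h45] at hrel
        linear_combination (conj (A 1 2) - A 1 2) * m14 - A 1 4 * hrel
      have : (A 1 4 - A 1 2) * (A 1 4 + A 1 2) = 0 := by
        rw [← hx] at m12
        linear_combination m14 - m12
      rcases mul_eq_zero.1 this with e | e
      · exact caseA (sub_eq_zero.1 e)
      · exact caseB (eq_neg_of_add_eq_zero_left e)
    · have h45 : A 4 5 = A 1 4 := by linear_combination k3 - h15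
      have h41 : A 4 1 = A 1 4 := by rw [← c41, hy]
      have h42 : A 4 2 = -A 1 4 := by rw [← c42, h24, map_neg, hy]
      have h43 : A 4 3 = -A 1 4 := by linear_combination r4 - h45 - h41 - h42
      exact hA.isDonutEquivalent_of_injective (v := ![0, 4, 1, 5, 2, 3]) (by decide) rfl
        (by simp [h41, h45]) (by simp [h41, h42]) (by simp [h41, h43])

theorem isDonutEquivalent_of_opposite (hA : IsNormalizedConference A) (h13 : A 1 3 = -A 1 2)
    (h15 : A 1 5 = -A 1 4) : IsDonutEquivalent A := by
  have n12 := hA.norm_apply 1 2 (by decide)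
  have n14 := hA.norm_apply 1 4 (by decide)
  have n23 := hA.norm_apply 2 3 (by decide)
  have n24 := hA.norm_apply 2 4 (by decide)
  have n25 := hA.norm_apply 2 5 (by decide)
  have hs := hA.sum_eq_zero 1 2 (by decide)
  rw [hA.apply_zero 1 (by decide), hA.zero_apply 2 (by decide), hA.apply_self, hA.apply_self, h13,
    h15, ← hA.conj_apply 2 3, ← hA.conj_apply 2 4, ← hA.conj_apply 2 5] at hs
  have r2 := hA.row_sum 2 (by decide)
  rw [hA.apply_self, ← hA.conj_apply 1 2] at r2
  -- The four terms are those of the vanishing inner product of rows 1 and 2. The first pairing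
  -- makes row 2 balanced; the third becomes the second on exchanging indices 4 and 5.
  rcases opposite_pairs_of_sum_eq_zero (a := 1) (b := -A 1 2 * conj (A 2 3))
    (c := A 1 4 * conj (A 2 4)) (d := -A 1 4 * conj (A 2 5)) (by simp) (by simp [n12, n23])
    (by simp [n14, n24]) (by simp [n14, n25]) (by linear_combination hs) with
    ⟨k1, k2⟩ | ⟨k1, k2⟩ | ⟨k1, k2⟩
  · have h23 : A 2 3 = A 1 2 := by
      linear_combination A 2 3 * k1 + A 1 2 * conj_mul_self_of_norm_one n23
    have h25 : A 2 5 = A 2 4 := by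
      have : conj (A 2 5) = conj (A 2 4) := by
        linear_combination (-conj (A 1 4)) * k2 +
          (conj (A 2 4) - conj (A 2 5)) * mul_conj_self_of_norm_one n14
      simpa using congrArg conj this
    obtain ⟨hx, h24⟩ := eq_one_or_neg_one_of_add_conj n12 n24
      (by linear_combination r2 - h23 - h25)
    have h21 : A 2 1 = A 1 2 := by
      rw [← hA.conj_apply 1 2]
      rcases hx with hx | hx <;> simp [hx]
    exact hA.isDonutEquivalent_of_injective (v := ![0, 2, 1, 3, 4, 5]) (by decide) rfl
      (by simp [h21, h23]) (by simp [h21, h24]) (by simp [h21, h24, h25])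
  · refine hA.isDonutEquivalent_of_neg h13 h15 ?_ (by linear_combination -k2)
    linear_combination A 2 4 * k1 - A 1 4 * conj_mul_self_of_norm_one n24
  · have h25 : A 2 5 = A 1 4 := by
      linear_combination A 2 5 * k1 + A 1 4 * conj_mul_self_of_norm_one n25
    have hv : Function.Injective (![0, 1, 2, 3, 5, 4] : Fin 6 → Fin 6) := by decide
    refine isDonutEquivalent_of_submatrix hv
      ((hA.submatrix hv rfl).isDonutEquivalent_of_neg ?_ ?_ ?_ ?_)
    · simp [h13]
    · simp [h15]
    · simp [h15, h25]
    · simp only [Matrix.submatrix_apply, Matrix.cons_val, h15]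
      linear_combination -k2

theorem isDonutEquivalent (hA : IsNormalizedConference A) : IsDonutEquivalent A := by
  have r1 := hA.row_sum 1 (by decide)
  rw [hA.apply_self] at r1
  rcases opposite_pairs_of_sum_eq_zero (hA.norm_apply 1 2 (by decide))
    (hA.norm_apply 1 3 (by decide)) (hA.norm_apply 1 4 (by decide))
    (hA.norm_apply 1 5 (by decide)) (by linear_combination r1) with
    ⟨k1, k2⟩ | ⟨k1, k2⟩ | ⟨k1, k2⟩
  · exact hA.isDonutEquivalent_of_opposite (by linear_combination k1) (by linear_combination k2)
  · have hv : Function.Injective (![0, 1, 2, 4, 3, 5] : Fin 6 → Fin 6) := by decide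
    exact isDonutEquivalent_of_submatrix hv ((hA.submatrix hv rfl).isDonutEquivalent_of_opposite
      (by simpa using eq_neg_of_add_eq_zero_right k1)
      (by simpa using eq_neg_of_add_eq_zero_right k2))
  · have hv : Function.Injective (![0, 1, 2, 5, 3, 4] : Fin 6 → Fin 6) := by decide
    exact isDonutEquivalent_of_submatrix hv ((hA.submatrix hv rfl).isDonutEquivalent_of_opposite
      (by simpa using eq_neg_of_add_eq_zero_right k1)
      (by simpa using eq_neg_of_add_eq_zero_right k2))

end IsNormalizedConference

/-! ### Passage to conference matrices, and assembly of the cases -/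

theorem IsDonutGainMatrix.isDonutEquivalent_of_three
    {A : Matrix (Fin (0 + 3) ⊕ Fin (0 + 3)) (Fin (0 + 3) ⊕ Fin (0 + 3)) ℂ}
    (hA : IsDonutGainMatrix A) : IsDonutEquivalent A := by
  let f : Fin 6 → Fin (0 + 3) ⊕ Fin (0 + 3) :=
    ![.inl 0, .inl 1, .inl 2, .inr 0, .inr 1, .inr 2]
  have hf : Function.Bijective f := by decide
  have hadj : ∀ u v : Fin (0 + 3) ⊕ Fin (0 + 3), (donutGraph (0 + 3)).Adj u v ↔ u ≠ v := by
    intro u v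
    rw [donutGraph_adj_iff]
    revert u v
    decide
  -- The graph is complete, so switching by the conjugated row of `f 0` makes that row 1 off the
  -- diagonal.
  let s : Fin (0 + 3) ⊕ Fin (0 + 3) → ℂ := fun u => if u = f 0 then 1 else conj (A (f 0) u)
  have hs : ∀ u, ‖s u‖ = 1 := by
    intro u
    by_cases hu : u = f 0
    · simp [s, hu]
    · simp [s, hu, hA.norm_apply _ _ ((hadj _ _).2 (Ne.symm hu))]
  have hB := hA.switch hs
  set B := Matrix.of fun u v => conj (s u) * A u v * s v with hBdef
  have hN : IsNormalizedConference (B.submatrix f f) := by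
    refine ⟨fun i j => hB.conj_apply _ _, fun i j h => hB.norm_apply _ _ ?_,
      fun i => hB.apply_eq_zero _ _ (SimpleGraph.irrefl _), ?_, fun i hi => ?_⟩
    · exact (hadj _ _).2 (hf.1.ne h)
    · have := Matrix.submatrix_mul_equiv B B f (Equiv.ofBijective f hf) f
      rw [Equiv.coe_ofBijective] at this
      rw [this, hB.mul_self, Matrix.submatrix_smul, Pi.smul_apply, Pi.smul_apply,
        Matrix.submatrix_one _ hf.1]
    · have hne : f i ≠ f 0 := hf.1.ne hi
      have := mul_conj_self_of_norm_one (hA.norm_apply _ _ ((hadj _ _).2 hne.symm))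
      simp [hBdef, s, hne, this]
  exact (hN.isDonutEquivalent.of_switchEquivalent
    (SwitchEquivalent.of_submatrix B (Equiv.ofBijective f hf))).of_switchEquivalent
    (SwitchEquivalent.of_switch A s hs)

theorem mainTheorem3 {V : Type*} [Fintype V] [DecidableEq V] (t : ℕ) (ht : 3 ≤ t)
    (G : SimpleGraph V) (hG : Nonempty (G ≃g donutGraph t)) (Ψ : UnitGainGraph G) :
    Ψ.eigenvalues = {((√5 : ℝ) : ℂ), -((√5 : ℝ) : ℂ)} ↔
      (∃ C : Matrix (Fin t) (Fin t) ℂ, IsWeighingMatrix C 1 ∧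
          Ψ.SwitchingIsomorphicToMatrix (donutMatrix C)) ∨
        ∃ c : Circle, Ψ.SwitchingIsomorphicToMatrix (dStarEight c) := by
  obtain ⟨n, rfl⟩ : ∃ n, t = n + 3 := ⟨t - 3, by omega⟩
  obtain ⟨e⟩ := hG
  have : Nonempty V := ⟨e.symm (.inl 0)⟩
  rw [Ψ.eigenvalues_eq_iff (by norm_num : (0 : ℝ) < 5)]
  constructor
  · intro h
    have hA : IsDonutGainMatrix (Ψ.gainMatrix.submatrix e.symm e.symm) := by
      refine ⟨fun u v => Ψ.conj_gainMatrix _ _, fun u v huv => ?_, fun u v huv => ?_, ?_⟩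
      · exact Ψ.norm_gainMatrix (e.symm.map_adj_iff.2 huv)
      · exact Ψ.gainMatrix_of_not_adj fun k => huv (e.symm.map_adj_iff.1 k)
      · have := Matrix.submatrix_mul_equiv Ψ.gainMatrix Ψ.gainMatrix e.symm e.symm.toEquiv e.symm
        refine this.trans ?_
        rw [h, Matrix.submatrix_smul, Pi.smul_apply, Pi.smul_apply,
          Matrix.submatrix_one _ e.symm.injective]
        simp
    have hΨ : SwitchEquivalent Ψ.gainMatrix (Ψ.gainMatrix.submatrix e.symm e.symm) :=
      SwitchEquivalent.of_submatrix Ψ.gainMatrix e.symm.toEquiv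
    rcases Nat.lt_or_ge n 2 with hn | hn
    · interval_cases n
      · obtain ⟨C, hC, hAC⟩ := hA.isDonutEquivalent_of_three
        exact Or.inl ⟨C, hC, Ψ.switchingIsomorphicToMatrix_of_switchEquivalent (hΨ.trans hAC)⟩
      · obtain ⟨B, hAB, hB⟩ := hA.exists_normalized
        rcases hB.exists_switchEquivalent_of_four with ⟨C, hC, hBC⟩ | ⟨c, hc⟩
        · exact Or.inl ⟨C, hC, Ψ.switchingIsomorphicToMatrix_of_switchEquivalent
            (hBC ▸ hΨ.trans hAB)⟩
        · exact Or.inr ⟨c, Ψ.switchingIsomorphicToMatrix_of_switchEquivalent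
            ((hΨ.trans hAB).trans hc)⟩
    · obtain ⟨B, hAB, hB⟩ := hA.exists_normalized
      obtain ⟨C, hC, hBC⟩ := hB.exists_eq_donutMatrix_of_two_le hn
      exact Or.inl ⟨C, hC, Ψ.switchingIsomorphicToMatrix_of_switchEquivalent
        (hBC ▸ hΨ.trans hAB)⟩
  · rintro (⟨C, hC, h⟩ | ⟨c, h⟩)
    · exact Ψ.mul_self_of_switchingIsomorphicToMatrix h (by simpa using donutMatrix_mul_self hC)
    · exact Ψ.mul_self_of_switchingIsomorphicToMatrix h (by simpa using dStarEight_mul_self c)
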